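/- **Setting.** Let $G$ be a countable infinite discrete group. *Rank one.* Let $T=(T_g)_{g\in G}$ be a nonsingular action of $G$ on a standard $\sigma$-finite non-atomic measure space $(Z,\eta)$ that is free (almost every point has trivial stabilizer). A *Rokhlin tower* is a pair $(B,F)$ with $B\subset Z$ Borel, $0<\eta(B)<\infty$, $F\subset G$ finite, $1_G\in F$, the sets $T_fB$ ($f\in F$) pairwise disjoint, and $\frac{d\eta\circ T_f}{d\eta}$ a.e. constant on $B$ for each $f\in F$. For $x\in T_fB$, $f\in F$, put $O_{B,F}(x)=\{T_gx: g\in Ff^{-1}\}$. Let $\{1_G\}=Q_0\subset Q_1\subset Q_2\subset\cdots$ be finite subsets of $G$. The action $T$ is *of rank one along* $(Q_n)$ if there are $B_0\supset B_1\supset\cdots$ such that every $(B_n,Q_n)$ is a Rokhlin tower and 1. for each $n$, every level $T_fB_n$ ($f\in Q_n$) is (mod 0) a union of levels $T_hB_{n+1}$ ($h\in Q_{n+1}$), and, off a null set, the towers cover $Z$ and their levels separate points; 2. for a.e. $x$ and every $g\in G$, $T_gx\in O_{B_n,Q_n}(x)$ for all sufficiently large $n$. *$(C,F)$-actions.* Let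 $(F_n)_{n\ge0}$ and $(C_n)_{n\ge1}$ be finite subsets of $G$ such that $F_0=\{1_G\}$, $1_G\in F_n\cap C_n$ and $\#C_n>1$ for $n\ge1$, and, for all $n\ge 0$, $F_nC_{n+1}\subset F_{n+1}$ and $F_nc\cap F_nc'=\emptyset$ for distinct $c,c'\in C_{n+1}$. Let $X$ be the topological inductive limit of the spaces $X_n=F_n\times C_{n+1}\times C_{n+2}\times\cdots$ (product topology) along the embeddings $(f_n,c_{n+1},c_{n+2},\dots)\mapsto(f_nc_{n+1},c_{n+2},\dots)$, and let $[f]_n\subset X_n$ be the set of points with first coordinate $f$. Assume $(\ast)$ for each $g\in G$ and $n>0$ there is $m>n$ with $gF_nC_{n+1}\cdots C_m\subset F_m$. The *$(C,F)$-action* on $X$ is $T_g(f_n,c_{n+1},\dots)=(gf_n,c_{n+1},\dots)$ whenever $f_n,gf_n\in F_n$. Given weights $\kappa_n>0$ on $C_n$ ($n\ge1$) with total mass $1$ and $\nu_n>0$ on $F_n$ ($n\ge0$), such that $\prod_{n>0}\max_{c\in C_n}\kappa_n(c)=0$ and $\nu_{n+1}(fc)=\nu_n(f)\kappa_{n+1}(c)$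 for $f\in F_n$, $c\in C_{n+1}$, the *$(C,F)$-measure* is the Borel measure $\mu$ on $X$ with $\mu([f]_n)=\nu_n(f)$ for all $n\ge 0$ and $f\in F_n$. *Unique ergodicity.* A *locally compact Cantor space* is a nonempty locally compact, second countable, Hausdorff, totally disconnected space without isolated points. A continuous action on such a space is *Radon uniquely ergodic* if it has a nonzero invariant Radon measure and every invariant Radon measure is a multiple of it. For a cocycle $\rho$, that is, Borel maps $\rho_g>0$ with $\rho_{g_2}(g_1x)\rho_{g_1}(x)=\rho_{g_2g_1}(x)$, the action is *Radon $\rho$-uniquely ergodic* if, up to scaling, there is exactly one nonzero quasi-invariant Radon measure $\gamma$ with $\frac{d\gamma\circ g}{d\gamma}=\rho_g$ a.e. for all $g\in G$. **Theorem 1.19 (Theorem B).** Let a free nonsingular action $R$ of $G$ on a standard $\sigma$-finite non-atomic measure space $(Z,\eta)$ be of rank one along $(Q_n)_{n\ge0}$. Then there are sequences $(C_n',F_{n-1}',\kappa_n',\nu_{n-1}')_{n\ge1}$ as above, satisfying $(\ast)$, whose $(C,F)$-space $X'$, $(C,F)$-action $T'$ and $(C,F)$-measure $\mu'$ have the following properties.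 1. $X'$ is a locally compact Cantor space. The action $T'$ is continuous, minimal, free (every point has trivial stabilizer) and Radon uniquely ergodic. There is exactly one $T'$-invariant Radon measure $\xi$ with $\xi(X'_0)=1$, where $X'_0$ is the image of $F_0'\times C_1'\times C_2'\times\cdots$. 2. $\mu'$ is a $T'$-quasi-invariant Radon measure. The Radon–Nikodym derivatives $\rho_g=\frac{d\mu'\circ T'_g}{d\mu'}:X'\to(0,\infty)$ are continuous (that is, have continuous versions forming a cocycle). 3. There is a measure-preserving Borel isomorphism $\varphi$ of $(Z,\eta)$ onto $(X',\mu')$ with $\varphi R_g=T'_g\varphi$ a.e. for each $g\in G$. 4. There are $z_n\in Q_n$ such that $(F_n')_{n\ge1}$ is a subsequence of $(Q_nz_n^{-1})_{n\ge1}$. 5. $T'$ is Radon $(\rho_g)_{g\in G}$-uniquely ergodic. Thus $\mu'$ is, up to scaling, the only nonzero quasi-invariant Radon measure with Radon–Nikodym cocycle $(\rho_g)$. -/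

import Mathlib

open MeasureTheory Set Filter Topology
open scoped NNReal ENNReal Pointwise

noncomputable section

namespace RankOne

/-! ### Actions on measure spaces -/

section Actions

variable {G : Type*} [Group G] {X : Type*} [MeasurableSpace X] [MulAction G X]

/-- The measure `μ ∘ T_g`, that is `A ↦ μ (T_g A)`, written as the image of `μ` under `T_g⁻¹`. -/
def compMeasure (μ : Measure X) (g : G) : Measure X :=
  μ.map (fun x : X => g⁻¹ • x)

variable (G) in
/-- The action is by measurable maps that preserve the class of `μ`. Since the condition is imposed
for `g` and for `g⁻¹`, it says `μ ∘ T_g ∼ μ` for every `g`. -/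
def QuasiInvariant (μ : Measure X) : Prop :=
  ∀ g : G, Measure.QuasiMeasurePreserving (fun x : X => g • x) μ μ

variable (G) in
/-- Freeness of a measured action: almost every point has a trivial stabilizer. -/
def FreeAE (μ : Measure X) : Prop :=
  ∀ g : G, g ≠ 1 → ∀ᵐ x ∂μ, g • x ≠ x

/-- `(B, F)` is a Rokhlin tower: the levels `T_f B`, `f ∈ F`, are disjoint, and each derivative
`d(μ ∘ T_f)/dμ`, `f ∈ F`, is (a.e.) constant on `B`. -/
structure IsRokhlinTower (μ : Measure X) (B : Set X) (F : Finset G) : Prop where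
  measurableSet : MeasurableSet B
  pos : 0 < μ B
  lt_top : μ B < ∞
  one_mem : (1 : G) ∈ F
  disjoint : ∀ f ∈ F, ∀ f' ∈ F, f ≠ f' → Disjoint (f • B) (f' • B)
  const_rnDeriv : ∀ f ∈ F, ∃ c : ℝ≥0∞,
    (compMeasure μ f).rnDeriv μ =ᵐ[μ.restrict B] fun _ => c

/-- The piece `{T_g x | g ∈ F f⁻¹}` (where `x ∈ T_f B`) of the orbit of `x` seen by the tower
`(B, F)`; it is empty if `x` is outside the tower. -/
def orbitPiece (B : Set X) (F : Finset G) (x : X) : Set X :=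
  {y | ∃ f ∈ F, x ∈ f • B ∧ ∃ h ∈ F, y = (h * f⁻¹) • x}

/-- The action is of rank one along `F 0 = {1} ⊆ F 1 ⊆ F 2 ⊆ ⋯`. -/
def IsRankOneAlong (μ : Measure X) (F : ℕ → Finset G) : Prop :=
  F 0 = {1} ∧ Monotone F ∧
  ∃ B : ℕ → Set X, Antitone B ∧ (∀ n, IsRokhlinTower μ (B n) (F n)) ∧
    -- every level of a tower is, mod `0`, a union of levels of the next tower
    (∀ n, ∀ f ∈ F n, ∃ S ⊆ F (n + 1), f • B n =ᵐ[μ] ⋃ h ∈ S, h • B (n + 1)) ∧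
    -- the towers exhaust the space and their levels separate points, mod `0`
    (∃ X₀ : Set X, (∀ᵐ x ∂μ, x ∈ X₀) ∧
      (∀ x ∈ X₀, ∃ n, ∃ f ∈ F n, x ∈ f • B n) ∧
      ∀ x ∈ X₀, ∀ y ∈ X₀, x ≠ y → ∃ n, ∃ f ∈ F n, x ∈ f • B n ∧ y ∉ f • B n) ∧
    -- the orbit pieces converge to the orbits
    (∀ᵐ x ∂μ, ∀ g : G, ∀ᶠ n in atTop, g • x ∈ orbitPiece (B n) (F n) x)

end Actions

/-! ### Continuous actions on locally compact spaces -/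

section TopologicalActions

/-- Nonempty zero-dimensional locally compact Polish spaces without isolated points. -/
structure IsLocallyCompactCantor (X : Type*) [TopologicalSpace X] : Prop where
  nonempty : Nonempty X
  t2 : T2Space X
  locallyCompact : LocallyCompactSpace X
  secondCountable : SecondCountableTopology X
  totallyDisconnected : TotallyDisconnectedSpace X
  perfect : PerfectSpace X

variable (G : Type*) [Group G] (X : Type*) [TopologicalSpace X] [MeasurableSpace X] [MulAction G X]

/-- Up to scaling, there is exactly one nonzero invariant Radon measure. -/
def IsRadonUniquelyErgodic : Prop :=
  ∃ ξ : Measure X, ξ ≠ 0 ∧ ξ.Regular ∧ SMulInvariantMeasure G X ξ ∧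
    ∀ ξ' : Measure X, ξ'.Regular → SMulInvariantMeasure G X ξ' → ∃ c : ℝ≥0, ξ' = c • ξ

variable {G X}

/-- A Borel cocycle of the action with values in the positive reals. -/
structure IsCocycle (ρ : G → X → ℝ≥0) : Prop where
  measurable : ∀ g, Measurable (ρ g)
  pos : ∀ g x, 0 < ρ g x
  mul : ∀ g₁ g₂ x, ρ g₂ (g₁ • x) * ρ g₁ x = ρ (g₂ * g₁) x

/-- `μ` is quasi-invariant and `d(μ ∘ T_g)/dμ = ρ g` for every `g`. -/
def HasRNCocycle (μ : Measure X) (ρ : G → X → ℝ≥0) : Prop :=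
  QuasiInvariant G μ ∧
    ∀ g : G, (compMeasure μ g).rnDeriv μ =ᵐ[μ] fun x => (ρ g x : ℝ≥0∞)

/-- Up to scaling, there is exactly one nonzero quasi-invariant Radon measure whose
Radon-Nikodym cocycle is `ρ`. -/
def IsRadonCocycleUniquelyErgodic (ρ : G → X → ℝ≥0) : Prop :=
  ∃ γ : Measure X, γ ≠ 0 ∧ γ.Regular ∧ HasRNCocycle γ ρ ∧
    ∀ γ' : Measure X, γ'.Regular → HasRNCocycle γ' ρ → ∃ c : ℝ≥0, γ' = c • γ

end TopologicalActions

/-! ### `(C,F)`-spaces, `(C,F)`-actions and `(C,F)`-measures -/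

/-- The sequences `(F n)`, `n ≥ 0`, and `(C n)`, `n ≥ 1`, of a `(C,F)`-construction
(`C 0` is not used). -/
structure CFShape (G : Type*) [Group G] where
  F : ℕ → Finset G
  C : ℕ → Finset G
  F_zero : F 0 = {1}
  one_mem_F : ∀ n, 1 ∈ F n
  one_mem_C : ∀ n, 1 ≤ n → 1 ∈ C n
  one_lt_card_C : ∀ n, 1 ≤ n → 1 < (C n).card
  mul_mem : ∀ n, ∀ f ∈ F n, ∀ c ∈ C (n + 1), f * c ∈ F (n + 1)
  disjoint : ∀ n, ∀ c ∈ C (n + 1), ∀ c' ∈ C (n + 1), c ≠ c' →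
    ∀ f ∈ F n, ∀ f' ∈ F n, f * c ≠ f' * c'

namespace CFShape

variable {G : Type*} [Group G] (S : CFShape G)

/-- `X_n = F_n × C_{n+1} × C_{n+2} × ⋯`. -/
abbrev Level (n : ℕ) : Type _ :=
  {f : G // f ∈ S.F n} × ((m : {m : ℕ // n < m}) → {c : G // c ∈ S.C m})

/-- The embedding `(f_n, c_{n+1}, c_{n+2}, …) ↦ (f_n c_{n+1}, c_{n+2}, …)` of `X_n` into
`X_{n+1}`. -/
def embed (n : ℕ) (x : S.Level n) : S.Level (n + 1) :=
  (⟨x.1 * x.2 ⟨n + 1, n.lt_succ_self⟩, S.mul_mem n _ x.1.2 _ (x.2 ⟨n + 1, n.lt_succ_self⟩).2⟩,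
    fun m => x.2 ⟨m, n.lt_succ_self.trans m.2⟩)

/-- The identifications that define the inductive limit. -/
inductive Glue : (Σ n, S.Level n) → (Σ n, S.Level n) → Prop
  | embed (n : ℕ) (x : S.Level n) : Glue ⟨n, x⟩ ⟨n + 1, S.embed n x⟩

/-- The `(C,F)`-space: the inductive limit of `X_0 → X_1 → X_2 → ⋯`. -/
def Space : Type _ := Quot S.Glue

/-- The canonical map of `X_n` into the inductive limit. -/
def point (n : ℕ) (x : S.Level n) : S.Space := Quot.mk _ ⟨n, x⟩

/-- The inductive limit topology (of the product topologies on the `X_n`). -/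
instance [TopologicalSpace G] : TopologicalSpace S.Space :=
  inferInstanceAs (TopologicalSpace (Quot S.Glue))

instance [TopologicalSpace G] : MeasurableSpace S.Space := borel _

instance [TopologicalSpace G] : BorelSpace S.Space := ⟨rfl⟩

/-- The cylinder `[f]_n`, the set of points `(f, c_{n+1}, c_{n+2}, …)` of `X_n`. -/
def cylinder (n : ℕ) (f : G) : Set S.Space :=
  {x | ∃ y : S.Level n, (y.1 : G) = f ∧ S.point n y = x}

/-- The set `F_n C_{n+1} C_{n+2} ⋯ C_{n+k}`. -/
def prodSet (n : ℕ) : ℕ → Set G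
  | 0 => S.F n
  | k + 1 => prodSet n k * (S.C (n + k + 1) : Set G)

/-- For each `g` and `n > 0` there is `m > n` with `g F_n C_{n+1} ⋯ C_m ⊆ F_m`. -/
def Absorbing : Prop :=
  ∀ g : G, ∀ n : ℕ, 0 < n → ∃ k : ℕ, 0 < k ∧ g • S.prodSet n k ⊆ (S.F (n + k) : Set G)

/-- The given action on the `(C,F)`-space is the `(C,F)`-action:
`T_g (f_n, c_{n+1}, …) = (g f_n, c_{n+1}, …)` whenever `f_n, g f_n ∈ F_n`. If `S` is absorbing
then every `g` and every point admit such an `n`, so this determines the action. -/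
def IsCFAction [MulAction G S.Space] : Prop :=
  ∀ (g : G) (n : ℕ) (x : S.Level n) (h : g * (x.1 : G) ∈ S.F n),
    g • S.point n x = S.point n (⟨g * x.1, h⟩, x.2)

end CFShape

/-- Nondegenerate probabilities `κ n` on `C n`, `n ≥ 1`, and nondegenerate finite measures `ν n` on
`F n`, `n ≥ 0`, given by their weights. Only the values of `κ n` on `C n` and of `ν n` on `F n`
are used. -/
structure CFWeights {G : Type*} [Group G] (S : CFShape G) where
  κ : ℕ → G → ℝ≥0
  ν : ℕ → G → ℝ≥0
  κ_pos : ∀ n, 1 ≤ n → ∀ c ∈ S.C n, 0 < κ n c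
  κ_sum : ∀ n, 1 ≤ n → ∑ c ∈ S.C n, κ n c = 1
  ν_pos : ∀ n, ∀ f ∈ S.F n, 0 < ν n f
  /-- `∏_{n > 0} max_{c ∈ C n} κ n c = 0`. -/
  prod_max : Tendsto (fun N : ℕ => ∏ n ∈ Finset.Icc 1 N, (S.C n).sup (κ n)) atTop (𝓝 0)
  ν_mul : ∀ n, ∀ f ∈ S.F n, ∀ c ∈ S.C (n + 1), ν (n + 1) (f * c) = ν n f * κ (n + 1) c

/-- `μ` is the `(C,F)`-measure determined by `κ` and `ν`, that is `μ [f]_n = ν_n (f)`. -/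
def CFWeights.IsCFMeasure {G : Type*} [Group G] [TopologicalSpace G] {S : CFShape G}
    (w : CFWeights S) (μ : Measure S.Space) : Prop :=
  ∀ n, ∀ f ∈ S.F n, μ (S.cylinder n f) = (w.ν n f : ℝ≥0∞)

end RankOne

end

noncomputable section

namespace RankOne

namespace CFShape

variable {G : Type*} [Group G] (S : CFShape G)

/-! ### Points of a `(C,F)`-space as germs of sequences in the group -/

/-! A rank-one action is coded by the positions of a point in a sparse subsequence of its towers.
After an invariant null set is discarded, the tower properties hold at every remaining point
(`IsRankOneAlong.nonempty_exactTowers`). Each chosen tower is re-based at one of its levels `z B_l`,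
so that `F_n = Q_l z⁻¹`. The set `C_{n+1}` records those levels of the next chosen tower that lie in
the base `A_n = z B_l` and whose translates by `F_n`, and then by a growing finite subset of `G`,
stay in that tower (`ExactTowers.exists_CFTowers`). Every point of the base eventually lies in such
a level, so a jump far enough ahead loses at most the proportion `2⁻ⁿ` of the base
(`ExactTowers.exists_next`).

By Borel-Cantelli almost every point is from some stage on never lost
(`CFTowers.measure_coded_compl`), and then it has a code `f_n, f_n c_{n+1}, …`. Coding is injective
because levels separate points, and it turns the action into left multiplication. The cylinder
`[f]_n` corresponds to `core n f`, the points of `f A_n` that are never lost again, rather than to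
the whole level. Levels scale `η` by constants, so the measures of the cores satisfy the
multiplicative rule of a `(C,F)`-measure (`CFTowers.weight_mul`). The coding map is finally
corrected on a null set to a Borel isomorphism (`exists_measurableEquiv_ae_eq`).

On the topological side, a point of a `(C,F)`-space is the germ at infinity of its partial products
(`germ_injective`), and `G` acts on germs by left multiplication; freeness, continuity and
minimality are then short. On `[1]_n` the cocycle of `f` is the constant `ν_n(f)/ν_n(1)`, so a
measure with this cocycle is proportional to `ν_n` on the cylinders of level `n`; additivity makes
the factor independent of `n` (`CFWeights.IsCFMeasure.eq_smul`). Equidistributed weights have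
cocycle `1` and give the invariant measure. -/

/-- The sequence of partial products `f_n c_{n+1} ⋯ c_k`, constant for `k ≤ n`. -/
def path (n : ℕ) (x : S.Level n) : ℕ → G
  | 0 => x.1
  | k + 1 => if h : n < k + 1 then path n x k * x.2 ⟨k + 1, h⟩ else x.1

/-- `p` is, from `n` on, the sequence of partial products of a point of `X_n`. -/
structure Valid (n : ℕ) (p : ℕ → G) : Prop where
  mem : p n ∈ S.F n
  step : ∀ k, n ≤ k → (p k)⁻¹ * p (k + 1) ∈ S.C (k + 1)

variable {S}

lemma path_of_le {n : ℕ} (x : S.Level n) : ∀ {k : ℕ}, k ≤ n → S.path n x k = x.1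
  | 0, _ => rfl
  | k + 1, h => by rw [path, dif_neg (by omega)]

lemma path_succ {n : ℕ} (x : S.Level n) {k : ℕ} (h : n ≤ k) :
    S.path n x (k + 1) = S.path n x k * x.2 ⟨k + 1, Nat.lt_succ_of_le h⟩ := by
  rw [path, dif_pos (Nat.lt_succ_of_le h)]

lemma valid_path {n : ℕ} (x : S.Level n) : S.Valid n (S.path n x) where
  mem := by rw [path_of_le x le_rfl]; exact x.1.2
  step k hk := by rw [path_succ x hk, inv_mul_cancel_left]; exact (x.2 _).2

namespace Valid

variable {n : ℕ} {p q : ℕ → G}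

lemma mem_of_le (h : S.Valid n p) {k : ℕ} (hk : n ≤ k) : p k ∈ S.F k := by
  induction k, hk using Nat.le_induction with
  | base => exact h.mem
  | succ k hk ih =>
    have := S.mul_mem k _ ih _ (h.step k hk)
    rwa [mul_inv_cancel_left] at this

lemma mono (h : S.Valid n p) {m : ℕ} (hm : n ≤ m) : S.Valid m p :=
  ⟨h.mem_of_le hm, fun k hk => h.step k (hm.trans hk)⟩

/-- The sets `F_k c`, `c ∈ C_{k+1}`, are disjoint, so an element of `F_k C_{k+1}` factors uniquely:
a later partial product determines all earlier ones. -/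
lemma eq_of_succ (hp : S.Valid n p) (hq : S.Valid n q) {k : ℕ} (hk : n ≤ k)
    (h : p (k + 1) = q (k + 1)) : p k = q k := by
  by_contra hne
  by_cases hc : (p k)⁻¹ * p (k + 1) = (q k)⁻¹ * q (k + 1)
  · rw [h] at hc
    exact hne (inv_injective (mul_right_cancel hc))
  · refine S.disjoint k _ (hp.step k hk) _ (hq.step k hk) hc _ (hp.mem_of_le hk) _
      (hq.mem_of_le hk) ?_
    rw [mul_inv_cancel_left, mul_inv_cancel_left, h]

lemma eq_of_eq (hp : S.Valid n p) (hq : S.Valid n q) {k N : ℕ} (hk : n ≤ k) (hN : k ≤ N)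
    (h : p N = q N) : p k = q k := by
  induction N, hN using Nat.le_induction with
  | base => exact h
  | succ N hN ih => exact ih (hp.eq_of_succ hq (hk.trans hN) h)

lemma eq_of_eventuallyEq (hp : S.Valid n p) (hq : S.Valid n q) (h : p =ᶠ[atTop] q) {k : ℕ}
    (hk : n ≤ k) : p k = q k := by
  obtain ⟨N, h1, h2⟩ := (h.and (eventually_ge_atTop k)).exists
  exact hp.eq_of_eq hq hk h2 h1

/-- Two sequences with a common term at `N` can be joined there. -/
lemma glue (hp : S.Valid n p) {m N : ℕ} (hq : S.Valid m q) (hn : n ≤ N) (hm : m ≤ N)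
    (h : p N = q N) : S.Valid n (fun k => if k ≤ N then p k else q k) where
  mem := by simpa [hn] using hp.mem
  step k hk := by
    rcases lt_trichotomy k N with hkN | rfl | hkN
    · simpa [hkN.le, Nat.succ_le_of_lt hkN] using hp.step k hk
    · simpa [h] using hq.step k hm
    · simpa [hkN.not_ge, show ¬ k + 1 ≤ N by omega] using hq.step k (hm.trans hkN.le)

/-- The point of `X_n` with a given sequence of partial products. -/
def toLevel (h : S.Valid n p) : S.Level n :=
  (⟨p n, h.mem⟩, fun m => ⟨(p (m.1 - 1))⁻¹ * p m, by
    have h1 := m.2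
    have := h.step (m.1 - 1) (by omega)
    rwa [Nat.sub_add_cancel (by omega)] at this⟩)

lemma path_toLevel (h : S.Valid n p) {k : ℕ} (hk : n ≤ k) : S.path n h.toLevel k = p k := by
  induction k, hk using Nat.le_induction with
  | base => rw [path_of_le _ le_rfl]; rfl
  | succ k hk ih => rw [path_succ _ hk, ih]; simp [toLevel]

end Valid

lemma level_ext {n : ℕ} {x y : S.Level n} (h : ∀ k, n ≤ k → S.path n x k = S.path n y k) :
    x = y := by
  refine Prod.ext (Subtype.ext ?_) (funext fun m => Subtype.ext ?_)
  · simpa [path_of_le] using h n le_rfl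
  · obtain ⟨m, hm⟩ := m
    obtain ⟨k, rfl⟩ : ∃ k, m = k + 1 := ⟨m - 1, by omega⟩
    have hk : n ≤ k := by omega
    have := h (k + 1) (by omega)
    rw [path_succ x hk, path_succ y hk, h k hk] at this
    exact mul_left_cancel this

lemma path_embed {n : ℕ} (x : S.Level n) {k : ℕ} (hk : n + 1 ≤ k) :
    S.path (n + 1) (S.embed n x) k = S.path n x k := by
  induction k, hk using Nat.le_induction with
  | base => rw [path_of_le _ le_rfl, path_succ x le_rfl, path_of_le x le_rfl]; rfl
  | succ k hk ih => rw [path_succ _ hk, path_succ x (by omega), ih]; rfl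

variable (S) in
/-- The germ at infinity of the sequence of partial products of a point. -/
def germ : S.Space → Germ (atTop : Filter ℕ) G :=
  Quot.lift (fun x => (S.path x.1 x.2 : Germ atTop G)) (by
    rintro _ _ ⟨n, x⟩
    refine Germ.coe_eq.2 ?_
    filter_upwards [eventually_ge_atTop (n + 1)] with k hk using (path_embed x hk).symm)

lemma germ_point (n : ℕ) (x : S.Level n) : S.germ (S.point n x) = (S.path n x : Germ atTop G) :=
  rfl

lemma point_embed (n : ℕ) (x : S.Level n) : S.point (n + 1) (S.embed n x) = S.point n x :=
  (Quot.sound (Glue.embed n x)).symm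

lemma exists_point_eq_of_le {n m : ℕ} (h : n ≤ m) (x : S.Level n) :
    ∃ y : S.Level m, S.point m y = S.point n x := by
  induction m, h using Nat.le_induction with
  | base => exact ⟨x, rfl⟩
  | succ m _ ih =>
    obtain ⟨y, hy⟩ := ih
    exact ⟨S.embed m y, (point_embed m y).trans hy⟩

lemma exists_point (ξ : S.Space) : ∃ n x, S.point n x = ξ := by
  induction ξ using Quot.ind with
  | mk a => exact ⟨a.1, a.2, rfl⟩

/-- Two points can be moved into a common `X_m`; there, agreement far out propagates back to every
coordinate. Identities in the inductive limit thus reduce to eventual identities between sequences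
in `G`. -/
lemma germ_injective : Function.Injective S.germ := by
  intro ξ ζ h
  obtain ⟨n, x, rfl⟩ := exists_point ξ
  obtain ⟨m, y, rfl⟩ := exists_point ζ
  obtain ⟨x', hx⟩ := exists_point_eq_of_le (le_max_left n m) x
  obtain ⟨y', hy⟩ := exists_point_eq_of_le (le_max_right n m) y
  rw [← hx, ← hy] at h ⊢
  rw [germ_point, germ_point, Germ.coe_eq] at h
  congr 1
  exact level_ext fun k hk => (valid_path x').eq_of_eventuallyEq (valid_path y') h hk

lemma Valid.germ_point_toLevel {n : ℕ} {p : ℕ → G} (h : S.Valid n p) :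
    S.germ (S.point n h.toLevel) = (p : Germ atTop G) := by
  rw [germ_point, Germ.coe_eq]
  filter_upwards [eventually_ge_atTop n] with k hk using h.path_toLevel hk

lemma exists_valid (ξ : S.Space) : ∃ n p, S.Valid n p ∧ S.germ ξ = (p : Germ atTop G) := by
  obtain ⟨n, x, rfl⟩ := exists_point ξ
  exact ⟨n, _, valid_path x, rfl⟩

lemma mem_range_germ {n : ℕ} {p : ℕ → G} (h : S.Valid n p) :
    ∃ ξ, S.germ ξ = (p : Germ atTop G) := ⟨_, h.germ_point_toLevel⟩

/-! ### Cylinders -/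

lemma mem_cylinder_iff {n : ℕ} {f : G} {ξ : S.Space} :
    ξ ∈ S.cylinder n f ↔ ∃ p, S.Valid n p ∧ p n = f ∧ S.germ ξ = (p : Germ atTop G) := by
  constructor
  · rintro ⟨y, rfl, rfl⟩
    exact ⟨_, valid_path y, path_of_le y le_rfl, rfl⟩
  · rintro ⟨p, hp, rfl, h⟩
    exact ⟨hp.toLevel, rfl, germ_injective (hp.germ_point_toLevel.trans h.symm)⟩

lemma Valid.mem_cylinder {n : ℕ} {p : ℕ → G} (h : S.Valid n p) {ξ : S.Space}
    (hξ : S.germ ξ = (p : Germ atTop G)) {k : ℕ} (hk : n ≤ k) : ξ ∈ S.cylinder k (p k) :=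
  mem_cylinder_iff.2 ⟨p, h.mono hk, rfl, hξ⟩

lemma Valid.eq_of_mem_cylinder {n : ℕ} {p : ℕ → G} (h : S.Valid n p) {ξ : S.Space}
    (hξ : S.germ ξ = (p : Germ atTop G)) {k : ℕ} (hk : n ≤ k) {f : G}
    (hf : ξ ∈ S.cylinder k f) : f = p k := by
  obtain ⟨q, hq, rfl, h'⟩ := mem_cylinder_iff.1 hf
  rw [hξ, Germ.coe_eq] at h'
  exact ((h.mono hk).eq_of_eventuallyEq hq h' le_rfl).symm

lemma mem_F_of_mem_cylinder {n : ℕ} {f : G} {ξ : S.Space} (h : ξ ∈ S.cylinder n f) :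
    f ∈ S.F n := by
  obtain ⟨p, hp, rfl, -⟩ := mem_cylinder_iff.1 h
  exact hp.mem

lemma eq_of_mem_cylinder {n : ℕ} {f f' : G} {ξ : S.Space} (h : ξ ∈ S.cylinder n f)
    (h' : ξ ∈ S.cylinder n f') : f = f' := by
  obtain ⟨p, hp, rfl, hξ⟩ := mem_cylinder_iff.1 h
  exact (hp.eq_of_mem_cylinder hξ le_rfl h').symm

lemma disjoint_cylinder {n : ℕ} {f f' : G} (h : f ≠ f') :
    Disjoint (S.cylinder n f) (S.cylinder n f') :=
  Set.disjoint_left.2 fun _ h1 h2 => h (eq_of_mem_cylinder h1 h2)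

lemma Valid.cylinder_subset {n : ℕ} {p : ℕ → G} (h : S.Valid n p) {k : ℕ} (hk : n ≤ k) :
    S.cylinder k (p k) ⊆ S.cylinder n (p n) := by
  intro ξ hξ
  obtain ⟨q, hq, h1, h2⟩ := mem_cylinder_iff.1 hξ
  -- The code of `ξ` starts only at `k`; the initial segment of `p` extends it back to `n`.
  refine mem_cylinder_iff.2 ⟨_, h.glue hq hk le_rfl h1.symm, by simp [hk], ?_⟩
  rw [h2, Germ.coe_eq]
  filter_upwards [eventually_gt_atTop k] with j hj
  rw [if_neg (by omega)]

/-- Cylinders form a tree: two of them are nested or disjoint. Both the basis property and the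
π-system argument for measures rest on this. -/
lemma cylinder_subset_of_mem {n m : ℕ} {f f' : G} {ξ : S.Space} (hnm : n ≤ m)
    (h : ξ ∈ S.cylinder n f) (h' : ξ ∈ S.cylinder m f') : S.cylinder m f' ⊆ S.cylinder n f := by
  obtain ⟨p, hp, rfl, hξ⟩ := mem_cylinder_iff.1 h
  rw [hp.eq_of_mem_cylinder hξ hnm h']
  exact hp.cylinder_subset hnm

/-- The sequence that is constant from `n` on, with value `f`. -/
lemma valid_const {n : ℕ} {f : G} (h : f ∈ S.F n) : S.Valid n (fun _ => f) :=
  ⟨h, fun k _ => by simpa using S.one_mem_C (k + 1) (by omega)⟩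

lemma cylinder_nonempty {n : ℕ} {f : G} (h : f ∈ S.F n) : (S.cylinder n f).Nonempty := by
  obtain ⟨ξ, hξ⟩ := mem_range_germ (valid_const h)
  exact ⟨ξ, (valid_const h).mem_cylinder hξ le_rfl⟩

lemma cylinder_eq_iUnion {n : ℕ} {f : G} (h : f ∈ S.F n) :
    S.cylinder n f = ⋃ c ∈ S.C (n + 1), S.cylinder (n + 1) (f * c) := by
  ext ξ
  simp only [mem_iUnion, exists_prop]
  constructor
  · intro hξ
    obtain ⟨p, hp, rfl, hg⟩ := mem_cylinder_iff.1 hξ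
    refine ⟨_, hp.step n le_rfl, ?_⟩
    rw [mul_inv_cancel_left]
    exact hp.mem_cylinder hg n.le_succ
  · rintro ⟨c, hc, hξ⟩
    obtain ⟨q, hq, h1, h2⟩ := mem_cylinder_iff.1 hξ
    have hv : S.Valid n (fun k => if k ≤ n then f else q k) := by
      refine ⟨by simpa using h, fun k hk => ?_⟩
      rcases hk.eq_or_lt with rfl | hk
      · simpa [h1] using hc
      · simpa [hk.not_ge, show ¬ k + 1 ≤ n by omega] using hq.step k hk
    refine mem_cylinder_iff.2 ⟨_, hv, by simp, ?_⟩
    rw [h2, Germ.coe_eq]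
    filter_upwards [eventually_gt_atTop n] with j hj
    rw [if_neg (by omega)]

lemma eventually_mem_cylinder (ξ : S.Space) : ∀ᶠ n in atTop, ∃ f ∈ S.F n, ξ ∈ S.cylinder n f := by
  obtain ⟨n, p, hp, hξ⟩ := exists_valid ξ
  filter_upwards [eventually_ge_atTop n] with k hk
  exact ⟨p k, hp.mem_of_le hk, hp.mem_cylinder hξ hk⟩

lemma range_point (n : ℕ) : Set.range (S.point n) = ⋃ f ∈ S.F n, S.cylinder n f := by
  ext ξ
  simp only [mem_range, mem_iUnion, exists_prop]
  constructor
  · rintro ⟨y, rfl⟩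
    exact ⟨y.1, y.1.2, y, rfl, rfl⟩
  · rintro ⟨f, -, y, -, rfl⟩
    exact ⟨y, rfl⟩

lemma range_point_zero : Set.range (S.point 0) = S.cylinder 0 1 := by
  simp [range_point, S.F_zero]

lemma iInter_cylinder_subsingleton {n : ℕ} (p : ℕ → G) :
    (⋂ k ≥ n, S.cylinder k (p k)).Subsingleton := by
  intro ξ hξ ζ hζ
  obtain ⟨a, q, hq, h1⟩ := exists_valid ξ
  obtain ⟨b, r, hr, h2⟩ := exists_valid ζ
  apply germ_injective
  rw [h1, h2, Germ.coe_eq]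
  filter_upwards [eventually_ge_atTop a, eventually_ge_atTop b, eventually_ge_atTop n]
    with k ha hb hn
  rw [← hq.eq_of_mem_cylinder h1 ha (mem_iInter₂.1 hξ k hn),
    ← hr.eq_of_mem_cylinder h2 hb (mem_iInter₂.1 hζ k hn)]

/-! ### The topology -/

section Topology

variable [TopologicalSpace G] [DiscreteTopology G]

lemma continuous_path (n k : ℕ) : Continuous fun x : S.Level n => S.path n x k := by
  induction k with
  | zero => exact continuous_subtype_val.comp continuous_fst
  | succ k ih =>
    by_cases h : n < k + 1
    · simp only [path, dif_pos h]
      exact ih.mul (continuous_subtype_val.comp ((continuous_apply _).comp continuous_snd))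
    · simp only [path, dif_neg h]
      exact continuous_subtype_val.comp continuous_fst

omit [DiscreteTopology G] in
lemma continuous_point (n : ℕ) : Continuous (S.point n) :=
  continuous_quot_mk.comp continuous_sigmaMk

omit [DiscreteTopology G] in
lemma isOpen_iff {U : Set S.Space} : IsOpen U ↔ ∀ n, IsOpen (S.point n ⁻¹' U) := by
  refine ⟨fun h n => h.preimage (continuous_point n), fun h => ?_⟩
  exact isOpen_coinduced.2 (isOpen_sigma_iff.2 h)

lemma isOpen_cylinder (n : ℕ) (f : G) : IsOpen (S.cylinder n f) := by
  refine isOpen_iff.2 fun m => isOpen_iff_mem_nhds.2 fun x hx => ?_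
  obtain ⟨q, hq, rfl, h⟩ := mem_cylinder_iff.1 hx
  rw [germ_point, Germ.coe_eq] at h
  have e : S.path m x (max m n) = q (max m n) :=
    ((valid_path x).mono (le_max_left m n)).eq_of_eventuallyEq (hq.mono (le_max_right m n)) h le_rfl
  have ho : IsOpen {y : S.Level m | S.path m y (max m n) = q (max m n)} :=
    (isOpen_discrete {q (max m n)}).preimage (continuous_path m (max m n))
  filter_upwards [ho.mem_nhds e] with y hy
  apply hq.cylinder_subset (le_max_right m n)
  rw [← show S.path m y (max m n) = q (max m n) from hy]
  exact (valid_path y).mem_cylinder rfl (le_max_left m n)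

lemma isCompact_cylinder (n : ℕ) (f : G) : IsCompact (S.cylinder n f) := by
  have : S.cylinder n f = S.point n '' {y | (y.1 : G) = f} := rfl
  rw [this]
  refine IsCompact.image ?_ (continuous_point n)
  refine IsClosed.isCompact ?_
  exact (isClosed_discrete {f}).preimage (continuous_subtype_val.comp continuous_fst)

omit [DiscreteTopology G] in
-- A basic open subset of the product `X_n` restricts finitely many coordinates, and the partial
-- product at an index beyond all of them fixes them.
lemma exists_cylinder_subset {U : Set S.Space} (hU : IsOpen U) {n : ℕ} {p : ℕ → G}
    (hp : S.Valid n p) {ξ : S.Space} (hξ : S.germ ξ = (p : Germ atTop G)) (h : ξ ∈ U) :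
    ∃ N, n ≤ N ∧ S.cylinder N (p N) ⊆ U := by
  obtain rfl : ξ = S.point n hp.toLevel := germ_injective (hξ.trans hp.germ_point_toLevel.symm)
  have hV : S.point n ⁻¹' U ∈ 𝓝 hp.toLevel := (isOpen_iff.1 hU n).mem_nhds h
  rw [nhds_prod_eq, Filter.mem_prod_iff] at hV
  obtain ⟨t₁, ht₁, t₂, ht₂, hsub⟩ := hV
  obtain ⟨v, hv, hvo, hmem⟩ := mem_nhds_iff.1 ht₂
  obtain ⟨I, u, hu, hIu⟩ := isOpen_pi_iff.1 hvo _ hmem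
  refine ⟨max n (I.sup fun m => m.1), le_max_left _ _, fun ζ hζ => ?_⟩
  obtain ⟨q, hq, h1, h2⟩ := mem_cylinder_iff.1 hζ
  have hg := hp.glue hq (le_max_left n (I.sup fun m => m.1)) le_rfl h1.symm
  obtain rfl : ζ = S.point n hg.toLevel := by
    apply germ_injective
    rw [hg.germ_point_toLevel, h2, Germ.coe_eq]
    filter_upwards [eventually_gt_atTop (max n (I.sup fun m => m.1))] with j hj
    rw [if_neg (by omega)]
  refine hsub ⟨?_, hv (hIu fun m hm => ?_)⟩
  · have : hg.toLevel.1 = hp.toLevel.1 := Subtype.ext (by simp [Valid.toLevel])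
    rw [this]
    exact mem_of_mem_nhds ht₁
  · have hle : m.1 ≤ max n (I.sup fun m => m.1) :=
      (Finset.le_sup (f := fun m : {m : ℕ // n < m} => m.1) hm).trans (le_max_right _ _)
    have : hg.toLevel.2 m = hp.toLevel.2 m := by
      refine Subtype.ext ?_
      simp only [Valid.toLevel]
      rw [if_pos hle, if_pos (by omega)]
    rw [this]
    exact (hu m hm).2

/-- The predicate `P` allows a restriction to the cylinders on which a given `g` acts by the
explicit formula, those with `f, g f ∈ F_n`. -/
lemma isTopologicalBasis_cylinder {P : ℕ → G → Prop}
    (hP : ∀ ξ, ∀ᶠ n in atTop, ∃ f, P n f ∧ ξ ∈ S.cylinder n f) :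
    TopologicalSpace.IsTopologicalBasis {U : Set S.Space | ∃ n f, P n f ∧ U = S.cylinder n f} := by
  refine TopologicalSpace.isTopologicalBasis_of_isOpen_of_nhds ?_ fun ξ U h hU => ?_
  · rintro _ ⟨n, f, -, rfl⟩
    exact isOpen_cylinder n f
  · obtain ⟨n, p, hp, hξ⟩ := exists_valid ξ
    obtain ⟨N, hN, hsub⟩ := exists_cylinder_subset hU hp hξ h
    obtain ⟨k, ⟨f, hf, hk⟩, hle⟩ := ((hP ξ).and (eventually_ge_atTop N)).exists
    refine ⟨_, ⟨k, f, hf, rfl⟩, hk, subset_trans ?_ hsub⟩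
    exact cylinder_subset_of_mem hle (hp.mem_cylinder hξ hN) hk

lemma isTopologicalBasis_cylinder_all :
    TopologicalSpace.IsTopologicalBasis
      {U : Set S.Space | ∃ n f, f ∈ S.F n ∧ U = S.cylinder n f} :=
  isTopologicalBasis_cylinder (P := fun n f => f ∈ S.F n) eventually_mem_cylinder

instance : T2Space S.Space := by
  refine ⟨fun ξ ζ hne => ?_⟩
  obtain ⟨n, p, hp, h1⟩ := exists_valid ξ
  obtain ⟨m, q, hq, h2⟩ := exists_valid ζ
  obtain ⟨k, hk, hkne⟩ : ∃ k ≥ max n m, p k ≠ q k := by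
    by_contra! h
    refine hne (germ_injective ?_)
    rw [h1, h2, Germ.coe_eq]
    filter_upwards [eventually_ge_atTop (max n m)] with k hk using h k hk
  exact ⟨_, _, isOpen_cylinder k _, isOpen_cylinder k _,
    hp.mem_cylinder h1 (le_trans (le_max_left _ _) hk),
    hq.mem_cylinder h2 (le_trans (le_max_right _ _) hk), disjoint_cylinder hkne⟩

lemma isClopen_cylinder (n : ℕ) (f : G) : IsClopen (S.cylinder n f) :=
  ⟨(isCompact_cylinder n f).isClosed, isOpen_cylinder n f⟩

instance : LocallyCompactSpace S.Space := by
  have : WeaklyLocallyCompactSpace S.Space := by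
    refine ⟨fun ξ => ?_⟩
    obtain ⟨n, f, -, hf⟩ := (eventually_mem_cylinder ξ).exists
    exact ⟨_, isCompact_cylinder n f, (isOpen_cylinder n f).mem_nhds hf⟩
  infer_instance

instance [Countable G] : SecondCountableTopology S.Space := by
  refine isTopologicalBasis_cylinder_all.secondCountableTopology ?_
  refine (countable_range fun a : ℕ × G => S.cylinder a.1 a.2).mono ?_
  rintro _ ⟨n, f, -, rfl⟩
  exact ⟨(n, f), rfl⟩

instance : TotallyDisconnectedSpace S.Space := by
  have : TotallySeparatedSpace S.Space := by
    refine totallySeparatedSpace_iff_exists_isClopen.2 fun ξ ζ hne => ?_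
    obtain ⟨n, f, -, hf, hsub⟩ : ∃ n f, f ∈ S.F n ∧ ξ ∈ S.cylinder n f ∧
        S.cylinder n f ⊆ {ζ}ᶜ := by
      obtain ⟨_, ⟨n, f, hf, rfl⟩, h1, h2⟩ := isTopologicalBasis_cylinder_all.exists_subset_of_mem_open
        (show ξ ∈ ({ζ} : Set S.Space)ᶜ from hne) isOpen_compl_singleton
      exact ⟨n, f, hf, h1, h2⟩
    exact ⟨_, isClopen_cylinder n f, hf, fun h => hsub h rfl⟩
  infer_instance

instance : PerfectSpace S.Space := by
  refine perfectSpace_iff_forall_not_isolated.2 fun ξ => ?_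
  rw [← mem_closure_iff_nhdsWithin_neBot, mem_closure_iff]
  intro U hU hξ
  obtain ⟨_, ⟨n, f, hf, rfl⟩, h1, h2⟩ := isTopologicalBasis_cylinder_all.exists_subset_of_mem_open
    hξ hU
  obtain ⟨c, hc, c', hc', hne⟩ := Finset.one_lt_card.1 (S.one_lt_card_C (n + 1) (by omega))
  obtain ⟨d, hd, hξd⟩ : ∃ d ∈ S.C (n + 1), ξ ∉ S.cylinder (n + 1) (f * d) := by
    by_cases h : ξ ∈ S.cylinder (n + 1) (f * c)
    · exact ⟨c', hc', fun h' => hne (mul_left_cancel (eq_of_mem_cylinder h h'))⟩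
    · exact ⟨c, hc, h⟩
  obtain ⟨ζ, hζ⟩ := cylinder_nonempty (S.mul_mem n f hf d hd)
  refine ⟨ζ, h2 ?_, fun h => hξd (h ▸ hζ)⟩
  rw [cylinder_eq_iUnion hf]
  exact mem_biUnion hd hζ

variable (S) in
theorem isLocallyCompactCantor [Countable G] : IsLocallyCompactCantor S.Space where
  nonempty := (cylinder_nonempty (S.one_mem_F 0)).to_type
  t2 := inferInstance
  locallyCompact := inferInstance
  secondCountable := inferInstance
  totallyDisconnected := inferInstance
  perfect := inferInstance

end Topology

end CFShape

end RankOne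

namespace RankOne

namespace CFShape

variable {G : Type*} [Group G] {S : CFShape G}

/-! ### The `(C,F)`-action -/

lemma path_translate {n : ℕ} (g : G) (x : S.Level n) (h : g * (x.1 : G) ∈ S.F n) {k : ℕ}
    (hk : n ≤ k) : S.path n (⟨g * x.1, h⟩, x.2) k = g * S.path n x k := by
  induction k, hk using Nat.le_induction with
  | base => rw [path_of_le _ le_rfl, path_of_le _ le_rfl]
  | succ k hk ih => rw [path_succ _ hk, path_succ _ hk, ih, mul_assoc]

lemma germ_translate {n : ℕ} (g : G) (x : S.Level n) (h : g * (x.1 : G) ∈ S.F n) :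
    S.germ (S.point n (⟨g * x.1, h⟩, x.2)) = g • S.germ (S.point n x) := by
  rw [germ_point, germ_point, ← Germ.coe_smul, Germ.coe_eq]
  filter_upwards [eventually_ge_atTop n] with k hk using path_translate g x h hk

lemma Valid.mem_prodSet {n : ℕ} {p : ℕ → G} (h : S.Valid n p) (k : ℕ) :
    p (n + k) ∈ S.prodSet n k := by
  induction k with
  | zero => exact h.mem
  | succ k ih =>
    exact Set.mem_mul.2 ⟨_, ih, _, h.step (n + k) (by omega), mul_inv_cancel_left _ _⟩

lemma Valid.const_mul {n : ℕ} {p : ℕ → G} (h : S.Valid n p) {g : G} (hg : g * p n ∈ S.F n) :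
    S.Valid n (fun k => g * p k) :=
  ⟨hg, fun k hk => by simpa [mul_assoc] using h.step k hk⟩

/-- Left multiplication does not change the steps `(p k)⁻¹ p (k+1)`, so once `g p_m` lies in `F_m`
it remains in the sets `F_k`. Absorption provides the first such index. -/
lemma Absorbing.eventually_mem (hA : S.Absorbing) {n : ℕ} {p : ℕ → G} (h : S.Valid n p) (g : G) :
    ∀ᶠ k in atTop, g * p k ∈ S.F k := by
  -- Absorption is available at positive levels only, hence `n + 1`.
  obtain ⟨k, -, hk⟩ := hA g (n + 1) n.succ_pos
  have hv := h.mono n.le_succ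
  have hm : g * p (n + 1 + k) ∈ S.F (n + 1 + k) :=
    hk (Set.smul_mem_smul_set (hv.mem_prodSet k))
  filter_upwards [eventually_ge_atTop (n + 1 + k)] with j hj
  exact ((hv.mono (Nat.le_add_right _ k)).const_mul hm).mem_of_le hj

/-- Left multiplication on germs preserves the `(C,F)`-space. -/
lemma Absorbing.exists_germ_smul (hA : S.Absorbing) (g : G) (ξ : S.Space) :
    ∃ ζ, S.germ ζ = g • S.germ ξ := by
  obtain ⟨n, p, hp, hξ⟩ := exists_valid ξ
  obtain ⟨k, hk, hkn⟩ := ((hA.eventually_mem hp g).and (eventually_ge_atTop n)).exists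
  rw [hξ]
  exact mem_range_germ ((hp.mono hkn).const_mul hk)

/-- The `(C,F)`-action. -/
@[reducible]
def Absorbing.mulAction (hA : S.Absorbing) : MulAction G S.Space :=
  letI : SMul G S.Space := ⟨fun g ξ => (hA.exists_germ_smul g ξ).choose⟩
  -- The action axioms are pulled back from left multiplication on germs.
  Function.Injective.mulAction S.germ germ_injective
    fun g ξ => (hA.exists_germ_smul g ξ).choose_spec

lemma Absorbing.isCFAction (hA : S.Absorbing) :
    letI := hA.mulAction
    S.IsCFAction := by
  let := hA.mulAction
  intro g n x h
  apply germ_injective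
  rw [germ_translate]
  exact (hA.exists_germ_smul g _).choose_spec

lemma Absorbing.eventually_mem_cylinder (hA : S.Absorbing) (g : G) (ξ : S.Space) :
    ∀ᶠ n in atTop, ∃ f, (f ∈ S.F n ∧ g * f ∈ S.F n) ∧ ξ ∈ S.cylinder n f := by
  obtain ⟨n, p, hp, hξ⟩ := exists_valid ξ
  filter_upwards [hA.eventually_mem hp g, eventually_ge_atTop n] with k hk hkn
  exact ⟨p k, ⟨hp.mem_of_le hkn, hk⟩, hp.mem_cylinder hξ hkn⟩

section Action

variable [MulAction G S.Space]

/-- The defining formula applies only when `g f_n ∈ F_n`; by absorption every point has a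
representation at such a level. -/
lemma IsCFAction.germ_smul (hG : S.IsCFAction) (hA : S.Absorbing) (g : G) (ξ : S.Space) :
    S.germ (g • ξ) = g • S.germ ξ := by
  obtain ⟨n, p, hp, hξ⟩ := exists_valid ξ
  obtain ⟨k, hk, hkn⟩ := ((hA.eventually_mem hp g).and (eventually_ge_atTop n)).exists
  have hk' := hp.mono hkn
  obtain rfl : ξ = S.point k hk'.toLevel :=
    germ_injective (hξ.trans hk'.germ_point_toLevel.symm)
  have hm : g * (hk'.toLevel.1 : G) ∈ S.F k := hk
  rw [hG g k _ hm, germ_translate]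

lemma IsCFAction.smul_mem_cylinder (hG : S.IsCFAction) {g : G} {n : ℕ} {f : G}
    (hf : g * f ∈ S.F n) {ξ : S.Space} (h : ξ ∈ S.cylinder n f) :
    g • ξ ∈ S.cylinder n (g * f) := by
  obtain ⟨y, rfl, rfl⟩ := h
  rw [hG g n y hf]
  exact ⟨_, rfl, rfl⟩

lemma IsCFAction.smul_mem_cylinder_iff (hG : S.IsCFAction) {g : G} {n : ℕ} {f : G}
    (hf : f ∈ S.F n) (hgf : g * f ∈ S.F n) {ξ : S.Space} :
    g • ξ ∈ S.cylinder n (g * f) ↔ ξ ∈ S.cylinder n f := by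
  refine ⟨fun h => ?_, hG.smul_mem_cylinder hgf⟩
  have := hG.smul_mem_cylinder (g := g⁻¹) (by rwa [inv_mul_cancel_left]) h
  rwa [inv_smul_smul, inv_mul_cancel_left] at this

lemma IsCFAction.smul_ne (hG : S.IsCFAction) (hA : S.Absorbing) {g : G} (hg : g ≠ 1)
    (ξ : S.Space) : g • ξ ≠ ξ := by
  intro h
  have h1 := hG.germ_smul hA g ξ
  obtain ⟨n, p, hp, hξ⟩ := exists_valid ξ
  rw [h, hξ, ← Germ.coe_smul, Germ.coe_eq] at h1
  obtain ⟨k, hk⟩ := h1.exists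
  exact hg (by simpa using hk.symm)

variable [TopologicalSpace G] [DiscreteTopology G]

lemma IsCFAction.continuousConstSMul (hG : S.IsCFAction) (hA : S.Absorbing) :
    ContinuousConstSMul G S.Space := by
  refine ⟨fun g => continuous_iff_continuousAt.2 fun ξ U hU => ?_⟩
  obtain ⟨V, hVU, hV, hξ⟩ := mem_nhds_iff.1 hU
  obtain ⟨n, p, hp, h⟩ := exists_valid (g • ξ)
  obtain ⟨N, hN, hsub⟩ := exists_cylinder_subset hV hp h hξ
  obtain ⟨k, ⟨f, ⟨hf, hgf⟩, hk⟩, hle⟩ :=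
    ((hA.eventually_mem_cylinder g ξ).and (eventually_ge_atTop N)).exists
  rw [Filter.mem_map]
  filter_upwards [(isOpen_cylinder k f).mem_nhds hk] with ζ hζ
  exact hVU (hsub (cylinder_subset_of_mem hle (hp.mem_cylinder h hN)
    (hG.smul_mem_cylinder hgf hk) (hG.smul_mem_cylinder hgf hζ)))

lemma IsCFAction.isMinimal (hG : S.IsCFAction) : MulAction.IsMinimal G S.Space := by
  refine ⟨fun ξ => isTopologicalBasis_cylinder_all.dense_iff.2 ?_⟩
  rintro _ ⟨n, f, hf, rfl⟩ -
  obtain ⟨k, ⟨f', hf', hk⟩, hle⟩ :=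
    ((CFShape.eventually_mem_cylinder ξ).and (eventually_ge_atTop n)).exists
  -- Since `f ∈ F_n ⊆ F_k`, the element `f f'⁻¹` carries `[f']_k` into `[f]_k ⊆ [f]_n`.
  have h := hG.smul_mem_cylinder (g := f * f'⁻¹)
    (by rw [inv_mul_cancel_right]; exact (valid_const hf).mem_of_le hle) hk
  rw [inv_mul_cancel_right] at h
  exact ⟨_, (valid_const hf).cylinder_subset hle h, mem_range_self _⟩

end Action

end CFShape

end RankOne

namespace RankOne

namespace CFShape

variable {G : Type*} [Group G] {S : CFShape G}
variable [TopologicalSpace G] [DiscreteTopology G]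

/-! ### Measures on a `(C,F)`-space -/

lemma measurableSet_cylinder (n : ℕ) (f : G) : MeasurableSet (S.cylinder n f) :=
  (isOpen_cylinder n f).measurableSet

omit [TopologicalSpace G] [DiscreteTopology G] in
lemma countable_setOf_cylinder [Countable G] (P : ℕ → G → Prop) :
    {U : Set S.Space | ∃ n f, P n f ∧ U = S.cylinder n f}.Countable := by
  refine (countable_range fun a : ℕ × G => S.cylinder a.1 a.2).mono ?_
  rintro _ ⟨n, f, -, rfl⟩
  exact ⟨(n, f), rfl⟩

lemma measurableSpace_eq_generateFrom [Countable G] {P : ℕ → G → Prop}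
    (hP : ∀ ξ, ∀ᶠ n in atTop, ∃ f, P n f ∧ ξ ∈ S.cylinder n f) :
    (inferInstance : MeasurableSpace S.Space) =
      MeasurableSpace.generateFrom {U : Set S.Space | ∃ n f, P n f ∧ U = S.cylinder n f} :=
  (isTopologicalBasis_cylinder hP).borel_eq_generateFrom

/-- A measure is determined by its values on sufficiently small cylinders. -/
lemma measure_ext [Countable G] {P : ℕ → G → Prop}
    (hP : ∀ ξ, ∀ᶠ n in atTop, ∃ f, P n f ∧ ξ ∈ S.cylinder n f) {μ ν : Measure S.Space}
    (hfin : ∀ n f, P n f → μ (S.cylinder n f) ≠ ∞)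
    (h : ∀ n f, P n f → μ (S.cylinder n f) = ν (S.cylinder n f)) : μ = ν := by
  refine Measure.ext_of_generateFrom_of_cover_subset (measurableSpace_eq_generateFrom hP) ?_
    (Subset.refl _) (countable_setOf_cylinder P) ?_ ?_ ?_
  · rintro _ ⟨n, f, hf, rfl⟩ _ ⟨m, f', hf', rfl⟩ ⟨ξ, h1, h2⟩
    rcases le_total n m with hnm | hnm
    · exact ⟨m, f', hf', inter_eq_right.2 (cylinder_subset_of_mem hnm h1 h2)⟩
    · exact ⟨n, f, hf, inter_eq_left.2 (cylinder_subset_of_mem hnm h2 h1)⟩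
  · refine eq_univ_of_forall fun ξ => ?_
    obtain ⟨n, f, hf, hξ⟩ := (hP ξ).exists
    exact ⟨_, ⟨n, f, hf, rfl⟩, hξ⟩
  · rintro _ ⟨n, f, hf, rfl⟩
    exact hfin n f hf
  · rintro _ ⟨n, f, hf, rfl⟩
    exact h n f hf

lemma measure_cylinder_eq_sum (μ : Measure S.Space) {n : ℕ} {f : G} (hf : f ∈ S.F n) :
    μ (S.cylinder n f) = ∑ c ∈ S.C (n + 1), μ (S.cylinder (n + 1) (f * c)) := by
  rw [cylinder_eq_iUnion hf, measure_biUnion_finset]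
  · intro c _ c' _ hne
    exact disjoint_cylinder fun h => hne (mul_left_cancel h)
  · exact fun c _ => measurableSet_cylinder _ _

lemma regular_of_cylinder_lt_top [Countable G] {μ : Measure S.Space}
    (h : ∀ n, ∀ f ∈ S.F n, μ (S.cylinder n f) < ∞) : μ.Regular := by
  have : IsLocallyFiniteMeasure μ := by
    refine ⟨fun ξ => ?_⟩
    obtain ⟨n, f, hf, hξ⟩ := (eventually_mem_cylinder ξ).exists
    exact ⟨_, (isOpen_cylinder n f).mem_nhds hξ, h n f hf⟩
  infer_instance

lemma cylinder_lt_top (μ : Measure S.Space) [IsFiniteMeasureOnCompacts μ] (n : ℕ) (f : G) :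
    μ (S.cylinder n f) < ∞ :=
  (isCompact_cylinder n f).measure_lt_top

section Action

variable [MulAction G S.Space]

lemma IsCFAction.compMeasure_cylinder (hG : S.IsCFAction) (hA : S.Absorbing) (μ : Measure S.Space)
    {g : G} {n : ℕ} {f : G} (hf : f ∈ S.F n) (hgf : g * f ∈ S.F n) :
    compMeasure μ g (S.cylinder n f) = μ (S.cylinder n (g * f)) := by
  have := hG.continuousConstSMul hA
  rw [compMeasure, Measure.map_apply (continuous_const_smul _).measurable
    (measurableSet_cylinder n f)]
  congr 1
  ext ξ
  have := hG.smul_mem_cylinder_iff (g := g⁻¹) hgf (by rwa [inv_mul_cancel_left]) (ξ := ξ)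
  rwa [inv_mul_cancel_left] at this

end Action

end CFShape

open CFShape

/-! ### Radon-Nikodym cocycles -/

section General

variable {G : Type*} [Group G] {X : Type*} [MeasurableSpace X] [MulAction G X]

lemma HasRNCocycle.of_compMeasure_eq {μ : Measure X} [SigmaFinite μ] {ρ : G → X → ℝ≥0}
    (hm : ∀ g : G, Measurable fun x : X => g • x) (hρ : ∀ g, Measurable (ρ g))
    (h : ∀ g, compMeasure μ g = μ.withDensity fun x => (ρ g x : ℝ≥0∞)) : HasRNCocycle μ ρ := by
  refine ⟨fun g => ⟨hm g, ?_⟩, fun g => ?_⟩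
  · have := h g⁻¹
    rw [compMeasure, inv_inv] at this
    rw [this]
    exact withDensity_absolutelyContinuous _ _
  · rw [h g]
    exact Measure.rnDeriv_withDensity _ (hρ g).coe_nnreal_ennreal

lemma QuasiInvariant.sigmaFinite_compMeasure {μ : Measure X} [SigmaFinite μ]
    (h : QuasiInvariant G μ) (g : G) : SigmaFinite (compMeasure μ g) := by
  let e : X ≃ᵐ X := ⟨MulAction.toPerm g⁻¹, (h g⁻¹).measurable,
    show Measurable fun x : X => (g⁻¹)⁻¹ • x by simpa using (h g).measurable⟩
  exact MeasurableEquiv.sigmaFinite_map e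

lemma HasRNCocycle.compMeasure_eq {μ : Measure X} [SigmaFinite μ] {ρ : G → X → ℝ≥0}
    (h : HasRNCocycle μ ρ) (g : G) :
    compMeasure μ g = μ.withDensity fun x => (ρ g x : ℝ≥0∞) := by
  have := h.1.sigmaFinite_compMeasure g
  rw [← withDensity_congr_ae (h.2 g)]
  exact (Measure.withDensity_rnDeriv_eq _ _ (h.1 g⁻¹).absolutelyContinuous).symm

end General

/-! ### The locally constant cocycle of a `(C,F)`-measure and its unique ergodicity. -/

namespace CFWeights

variable {G : Type*} [Group G] {S : CFShape G} (w : CFWeights S)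

/-- The derivative `d(μ ∘ T_g)/dμ` of the `(C,F)`-measure `μ`; it is `ν_n (g f) / ν_n (f)` on
`[f]_n` whenever `f, g f ∈ F_n`. -/
def cocycle (g : G) (ξ : S.Space) : ℝ≥0 :=
  open Classical in
  if h : ∃ r, ∃ n f, f ∈ S.F n ∧ g * f ∈ S.F n ∧ ξ ∈ S.cylinder n f ∧
    r = w.ν n (g * f) / w.ν n f then h.choose else 1

/-- Passing to the next level multiplies numerator and denominator by the same `κ_{k+1}(c)`. Hence
the derivative is well defined and constant on cylinders. -/
lemma ν_div_eq {n : ℕ} {p : ℕ → G} (hp : S.Valid n p) {g : G} (hg : g * p n ∈ S.F n) {k : ℕ}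
    (hk : n ≤ k) : w.ν k (g * p k) / w.ν k (p k) = w.ν n (g * p n) / w.ν n (p n) := by
  induction k, hk using Nat.le_induction with
  | base => rfl
  | succ k hk ih =>
    have hc := hp.step k hk
    have h1 := w.ν_mul k _ (hp.mem_of_le hk) _ hc
    have h2 := w.ν_mul k _ ((hp.const_mul hg).mem_of_le hk) _ hc
    rw [mul_inv_cancel_left] at h1
    rw [mul_assoc, mul_inv_cancel_left] at h2
    rw [← ih, h1, h2, mul_div_mul_right _ _ (w.κ_pos _ (by omega) _ hc).ne']

lemma cocycle_eq {g : G} {n : ℕ} {f : G} (hgf : g * f ∈ S.F n) {ξ : S.Space}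
    (hξ : ξ ∈ S.cylinder n f) : w.cocycle g ξ = w.ν n (g * f) / w.ν n f := by
  have hex : ∃ r, ∃ n f, f ∈ S.F n ∧ g * f ∈ S.F n ∧ ξ ∈ S.cylinder n f ∧
      r = w.ν n (g * f) / w.ν n f := ⟨_, n, f, mem_F_of_mem_cylinder hξ, hgf, hξ, rfl⟩
  rw [cocycle, dif_pos hex]
  obtain ⟨m, f', -, hgf', hξ', h⟩ := hex.choose_spec
  rw [h]
  obtain ⟨p, hp, rfl, hpξ⟩ := mem_cylinder_iff.1 hξ
  obtain ⟨q, hq, rfl, hqξ⟩ := mem_cylinder_iff.1 hξ'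
  rw [← w.ν_div_eq hp hgf (le_max_left n m), ← w.ν_div_eq hq hgf' (le_max_right n m),
    hp.eq_of_mem_cylinder hpξ (le_max_left n m) (hq.mem_cylinder hqξ (le_max_right n m))]

variable (hA : S.Absorbing)
include hA

lemma continuous_cocycle [TopologicalSpace G] [DiscreteTopology G] (g : G) :
    Continuous (w.cocycle g) := by
  refine continuous_iff_continuousAt.2 fun ξ => ?_
  obtain ⟨n, f, ⟨-, hgf⟩, hξ⟩ := (hA.eventually_mem_cylinder g ξ).exists
  have : w.cocycle g =ᶠ[𝓝 ξ] fun _ => w.ν n (g * f) / w.ν n f := by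
    filter_upwards [(isOpen_cylinder n f).mem_nhds hξ] with ζ hζ using w.cocycle_eq hgf hζ
  exact (continuousAt_congr this).2 continuousAt_const

variable [MulAction G S.Space]

lemma isCocycle_cocycle [TopologicalSpace G] [DiscreteTopology G] (hG : S.IsCFAction) :
    IsCocycle w.cocycle where
  measurable g := (w.continuous_cocycle hA g).measurable
  pos g ξ := by
    obtain ⟨n, f, ⟨hf, hgf⟩, hξ⟩ := (hA.eventually_mem_cylinder g ξ).exists
    rw [w.cocycle_eq hgf hξ]
    exact div_pos (w.ν_pos n _ hgf) (w.ν_pos n _ hf)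
  mul g₁ g₂ ξ := by
    obtain ⟨n, ⟨f, ⟨hf, h1⟩, hξ⟩, ⟨f', ⟨-, h2⟩, hξ'⟩⟩ :=
      ((hA.eventually_mem_cylinder g₁ ξ).and (hA.eventually_mem_cylinder (g₂ * g₁) ξ)).exists
    obtain rfl := eq_of_mem_cylinder hξ hξ'
    rw [w.cocycle_eq h1 hξ, w.cocycle_eq h2 hξ,
      w.cocycle_eq (by rwa [← mul_assoc]) (hG.smul_mem_cylinder h1 hξ), mul_assoc,
      div_mul_div_cancel₀ (w.ν_pos n _ h1).ne']

variable [TopologicalSpace G] [DiscreteTopology G] [Countable G]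

omit hA [MulAction G S.Space] in
lemma IsCFMeasure.regular {w : CFWeights S} {μ : Measure S.Space} (hμ : w.IsCFMeasure μ) :
    μ.Regular :=
  regular_of_cylinder_lt_top fun n f hf => by rw [hμ n f hf]; exact ENNReal.coe_lt_top

/-- It suffices to test cylinders with `f, g f ∈ F_n`; on these the cocycle is constant and both
sides equal `ν_n(g f)`. -/
lemma IsCFMeasure.compMeasure_eq {w : CFWeights S} {μ : Measure S.Space} (hμ : w.IsCFMeasure μ)
    (hG : S.IsCFAction) (g : G) :
    compMeasure μ g = μ.withDensity fun ξ => (w.cocycle g ξ : ℝ≥0∞) := by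
  refine measure_ext (hA.eventually_mem_cylinder g) ?_ ?_
  · rintro n f ⟨hf, hgf⟩
    rw [hG.compMeasure_cylinder hA μ hf hgf, hμ n _ hgf]
    exact ENNReal.coe_ne_top
  · rintro n f ⟨hf, hgf⟩
    rw [hG.compMeasure_cylinder hA μ hf hgf, hμ n _ hgf,
      withDensity_apply _ (measurableSet_cylinder n f),
      setLIntegral_congr_fun (measurableSet_cylinder n f)
        (fun ξ hξ => by rw [w.cocycle_eq hgf hξ]), setLIntegral_const, hμ n f hf,
      ← ENNReal.coe_mul, div_mul_cancel₀ _ (w.ν_pos n f hf).ne']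

lemma IsCFMeasure.hasRNCocycle {w : CFWeights S} {μ : Measure S.Space} (hμ : w.IsCFMeasure μ)
    (hG : S.IsCFAction) : HasRNCocycle μ w.cocycle := by
  have := hμ.regular
  have := hG.continuousConstSMul hA
  exact .of_compMeasure_eq (fun g => (continuous_const_smul g).measurable)
    (fun g => (w.continuous_cocycle hA g).measurable) (hμ.compMeasure_eq hA hG)

omit hA [MulAction G S.Space] in
/-- A measure whose values on the cylinders of each level are proportional to the weights is a
multiple of the `(C,F)`-measure. -/
lemma IsCFMeasure.eq_smul {w : CFWeights S} {μ : Measure S.Space} (hμ : w.IsCFMeasure μ)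
    {γ : Measure S.Space} [IsFiniteMeasureOnCompacts γ]
    (h : ∀ n, ∀ f ∈ S.F n,
      γ (S.cylinder n f) = ((w.ν n f / w.ν n 1 : ℝ≥0) : ℝ≥0∞) * γ (S.cylinder n 1)) :
    γ = ((γ (S.cylinder 0 1)).toNNReal / w.ν 0 1) • μ := by
  have h1 : ∀ n, w.ν n 1 ≠ 0 := fun n => (w.ν_pos n 1 (S.one_mem_F n)).ne'
  have hfin : ∀ n f, γ (S.cylinder n f) = ((γ (S.cylinder n f)).toNNReal : ℝ≥0∞) := fun n f =>
    (ENNReal.coe_toNNReal (cylinder_lt_top γ n f).ne).symm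
  set t : ℕ → ℝ≥0 := fun n => (γ (S.cylinder n 1)).toNNReal / w.ν n 1 with ht
  have hγ : ∀ n, ∀ f ∈ S.F n, γ (S.cylinder n f) = ((t n * w.ν n f : ℝ≥0) : ℝ≥0∞) := by
    intro n f hf
    rw [h n f hf, hfin n 1, ← ENNReal.coe_mul]
    congr 1
    simp only [ht]
    rw [div_mul_eq_mul_div, div_mul_eq_mul_div, mul_comm]
  -- Compare the mass of `[1]_n` with the sum over its subcylinders of level `n + 1`, using that
  -- `κ_{n+1}` has total mass `1`.
  have hstep : ∀ n, t (n + 1) = t n := by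
    intro n
    have := hγ n 1 (S.one_mem_F n)
    rw [measure_cylinder_eq_sum γ (S.one_mem_F n), Finset.sum_congr rfl fun c hc =>
      hγ (n + 1) _ (S.mul_mem n 1 (S.one_mem_F n) c hc), ← ENNReal.ofNNReal_finsetSum,
      ENNReal.coe_inj, ← Finset.mul_sum, Finset.sum_congr rfl fun c hc =>
      w.ν_mul n 1 (S.one_mem_F n) c hc, ← Finset.mul_sum, w.κ_sum (n + 1) (by omega), mul_one]
      at this
    exact mul_right_cancel₀ (h1 n) this
  have hconst : ∀ n, t n = t 0 := fun n => by
    induction n with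
    | zero => rfl
    | succ n ih => rw [hstep, ih]
  refine measure_ext (P := fun n f => f ∈ S.F n) eventually_mem_cylinder
    (fun n f _ => (cylinder_lt_top γ n f).ne) ?_
  intro n f hf
  rw [hγ n f hf, Measure.smul_apply, hμ n f hf, hconst n]
  rfl

lemma IsCFMeasure.isRadonCocycleUniquelyErgodic {w : CFWeights S} {μ : Measure S.Space}
    (hμ : w.IsCFMeasure μ) (hG : S.IsCFAction) : IsRadonCocycleUniquelyErgodic w.cocycle := by
  refine ⟨μ, ?_, hμ.regular, hμ.hasRNCocycle hA hG, fun γ hγ hργ => ⟨_, hμ.eq_smul ?_⟩⟩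
  · rintro rfl
    have := hμ 0 1 (S.one_mem_F 0)
    exact (w.ν_pos 0 1 (S.one_mem_F 0)).ne (by simpa using this)
  · intro n f hf
    have hf' : f * 1 ∈ S.F n := by rwa [mul_one]
    have h := hG.compMeasure_cylinder hA γ (S.one_mem_F n) hf'
    rw [hργ.compMeasure_eq, withDensity_apply _ (measurableSet_cylinder n 1),
      setLIntegral_congr_fun (measurableSet_cylinder n 1)
        (fun ξ hξ => by rw [w.cocycle_eq hf' hξ]), setLIntegral_const, mul_one] at h
    exact h.symm

end CFWeights

end RankOne

namespace RankOne

open CFShape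

/-! ### The invariant measure of a `(C,F)`-action -/

variable {G : Type*} [Group G] {S : CFShape G}

lemma CFShape.card_C_pos (n : ℕ) (hn : 1 ≤ n) : 0 < (S.C n).card :=
  zero_lt_one.trans (S.one_lt_card_C n hn)

variable (S) in
/-- The equidistributed weights, with total mass `1` on `X_0`. -/
def CFWeights.uniform : CFWeights S where
  κ n _ := ((S.C n).card : ℝ≥0)⁻¹
  ν n _ := ∏ i ∈ Finset.Icc 1 n, ((S.C i).card : ℝ≥0)⁻¹
  κ_pos n hn c _ := inv_pos.2 (Nat.cast_pos.2 (card_C_pos n hn))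
  κ_sum n hn := by
    rw [Finset.sum_const, nsmul_eq_mul, mul_inv_cancel₀]
    exact (Nat.cast_pos.2 (card_C_pos n hn)).ne'
  ν_pos n f _ := Finset.prod_pos fun i hi =>
    inv_pos.2 (Nat.cast_pos.2 (card_C_pos i (Finset.mem_Icc.1 hi).1))
  prod_max := by
    refine tendsto_of_tendsto_of_tendsto_of_le_of_le tendsto_const_nhds
      (NNReal.tendsto_pow_atTop_nhds_zero_of_lt_one (r := 2⁻¹) (by norm_num)) (fun _ => zero_le)
      fun N => ?_
    -- Each `C_n` has at least two elements, so each factor is at most `1/2`.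
    calc _ ≤ ∏ n ∈ Finset.Icc 1 N, (2⁻¹ : ℝ≥0) := by
          refine Finset.prod_le_prod' fun n hn => Finset.sup_le fun c _ => ?_
          refine inv_anti₀ (by norm_num) ?_
          exact_mod_cast S.one_lt_card_C n (Finset.mem_Icc.1 hn).1
      _ = _ := by simp
  ν_mul n f _ c _ := by rw [Finset.prod_Icc_succ_top (by omega)]

/-- From `m` on, the translate of `p` by `(p m)⁻¹` is the sequence of a point of `X_0`. -/
lemma CFShape.Valid.exists_eq_mul {m : ℕ} {p : ℕ → G} (hp : S.Valid m p) :
    ∃ q, S.Valid 0 q ∧ ∀ k, m ≤ k → q k = (p m)⁻¹ * p k := by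
  have h1 : S.Valid m (fun k => (p m)⁻¹ * p k) :=
    hp.const_mul (by simpa using S.one_mem_F m)
  have h0 : S.Valid 0 (fun _ => (1 : G)) := valid_const (S.one_mem_F 0)
  refine ⟨_, h0.glue h1 (Nat.zero_le m) le_rfl (by simp), fun k hk => ?_⟩
  rcases hk.eq_or_lt with rfl | hk
  · simp
  · simp [hk.not_ge]

lemma CFWeights.uniform_cocycle (hA : S.Absorbing) (g : G) (x : S.Space) :
    (CFWeights.uniform S).cocycle g x = 1 := by
  obtain ⟨n, f, ⟨hf, hgf⟩, hξ⟩ := (hA.eventually_mem_cylinder g x).exists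
  rw [cocycle_eq _ hgf hξ]
  exact div_self ((CFWeights.uniform S).ν_pos n f hf).ne'

variable [TopologicalSpace G] [DiscreteTopology G] [Countable G]

variable (S) in
/-- The image in the `(C,F)`-space of the equidistributed product measure on `X_0`. -/
lemma CFShape.exists_measure_level_zero : ∃ P : Measure S.Space, ∀ p, S.Valid 0 p →
    ∀ n, P (S.cylinder n (p n)) = ((CFWeights.uniform S).ν n (p n) : ℝ≥0∞) := by
  let : MeasurableSpace G := borel G
  have : BorelSpace G := ⟨rfl⟩
  have hne : ∀ m : {m : ℕ // 0 < m}, Nonempty {c : G // c ∈ S.C m} := fun m =>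
    ⟨⟨1, S.one_mem_C m m.2⟩⟩
  let U : (m : {m : ℕ // 0 < m}) → Measure {c : G // c ∈ S.C m} := fun m =>
    ProbabilityTheory.uniformOn univ
  have hU : ∀ m, IsProbabilityMeasure (U m) := fun m =>
    ProbabilityTheory.isProbabilityMeasure_uniformOn finite_univ univ_nonempty
  have hUs : ∀ (m : {m : ℕ // 0 < m}) (c : {c : G // c ∈ S.C m}),
      U m {c} = (((S.C m).card : ℝ≥0)⁻¹ : ℝ≥0) := by
    intro m c
    simp only [U]
    rw [ProbabilityTheory.uniformOn_univ, Measure.count_singleton, Fintype.card_coe, one_div,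
      ENNReal.coe_inv (Nat.cast_pos.2 (card_C_pos _ m.2)).ne', ENNReal.coe_natCast]
  let i : ((m : {m : ℕ // 0 < m}) → {c : G // c ∈ S.C m}) → S.Space := fun c =>
    S.point 0 (⟨1, S.one_mem_F 0⟩, c)
  have hi : Measurable i := by
    refine Continuous.measurable ?_
    exact (continuous_point 0).comp (continuous_const.prodMk continuous_id)
  refine ⟨(Measure.infinitePi U).map i, fun p hp n => ?_⟩
  have hp0 : p 0 = 1 := by simpa [S.F_zero] using hp.mem
  rw [Measure.map_apply hi (measurableSet_cylinder n _)]
  -- By unique factorization, the `n`-th partial product is `p n` exactly when the first `n`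
  -- coordinates are those of `p`; the preimage is a finite-dimensional box.
  have hpre : i ⁻¹' S.cylinder n (p n) =
      Set.pi (((Finset.Icc 1 n).subtype fun m => 0 < m : Finset {m : ℕ // 0 < m}) : Set _)
        fun m => {hp.toLevel.2 m} := by
    ext c
    simp only [mem_preimage, Set.mem_pi, Finset.mem_coe, Finset.mem_subtype, Finset.mem_Icc,
      mem_singleton_iff]
    set x : S.Level 0 := (⟨1, S.one_mem_F 0⟩, c) with hx
    constructor
    · intro h m hm
      have h1 := (valid_path x).eq_of_mem_cylinder (germ_point 0 x) (Nat.zero_le n) h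
      have h2 : ∀ k ≤ n, p k = S.path 0 x k := fun k hk =>
        hp.eq_of_eq (valid_path x) (Nat.zero_le k) hk h1
      obtain ⟨m, hm0⟩ := m
      obtain ⟨k, rfl⟩ : ∃ k, m = k + 1 := ⟨m - 1, by omega⟩
      refine Subtype.ext ?_
      simp only [Valid.toLevel, Nat.add_sub_cancel]
      have hk : k + 1 ≤ n := hm.2
      rw [h2 k (by omega), h2 (k + 1) hk, path_succ x (Nat.zero_le k), inv_mul_cancel_left]
    · intro h
      have h2 : ∀ k ≤ n, S.path 0 x k = p k := by
        intro k hk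
        induction k with
        | zero => rw [hp0]; rfl
        | succ k ih =>
          rw [path_succ x (Nat.zero_le k), ih (by omega)]
          have := h ⟨k + 1, k.succ_pos⟩ ⟨k.succ_pos, hk⟩
          simp only [hx]
          rw [this]
          simp [Valid.toLevel]
      rw [← h2 n le_rfl]
      exact (valid_path x).mem_cylinder (germ_point 0 x) (Nat.zero_le n)
  rw [hpre, Measure.infinitePi_pi _ fun m _ => measurableSet_singleton _]
  simp only [hUs]
  rw [← ENNReal.ofNNReal_finsetProd, Finset.prod_subtype_eq_prod_filter
    (fun m => ((S.C m).card : ℝ≥0)⁻¹), Finset.filter_true_of_mem]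
  · rfl
  · exact fun m hm => (Finset.mem_Icc.1 hm).1

section Action

variable [MulAction G S.Space]

/-- The product measure lives on `X_0` only. The space is partitioned into the cylinders `[f]_m`
that meet no earlier `X_k`. Each is the translate by `f` of `[1]_m ⊆ X_0`, so it receives the
translated product measure, and these pieces are summed. -/
theorem CFShape.exists_isCFMeasure_uniform (hA : S.Absorbing) (hG : S.IsCFAction) :
    ∃ ξ : Measure S.Space, (CFWeights.uniform S).IsCFMeasure ξ := by
  classical
  obtain ⟨P, hP⟩ := S.exists_measure_level_zero
  have := hG.continuousConstSMul hA
  -- the cylinders that are not contained in an earlier `X_k`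
  let New : ℕ → G → Prop := fun m f => f ∈ S.F m ∧
    ∀ k < m, ∀ f' ∈ S.F k, Disjoint (S.cylinder k f') (S.cylinder m f)
  let M : ℕ × G → Measure S.Space := fun a =>
    if New a.1 a.2 then (P.restrict (S.cylinder a.1 1)).map (fun x => a.2 • x) else 0
  refine ⟨Measure.sum M, fun n f hf => ?_⟩
  rw [Measure.sum_apply _ (measurableSet_cylinder n f)]
  have hM : ∀ m f', New m f' → M (m, f') (S.cylinder n f) =
      P ((fun x => f' • x) ⁻¹' S.cylinder n f ∩ S.cylinder m 1) := by
    intro m f' h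
    simp only [M]
    rw [if_pos h, Measure.map_apply (continuous_const_smul _).measurable
      (measurableSet_cylinder n f), Measure.restrict_apply]
    exact (continuous_const_smul f').measurable (measurableSet_cylinder n f)
  have hsmul : ∀ m f', f' ∈ S.F m → ∀ x ∈ S.cylinder m 1, f' • x ∈ S.cylinder m f' := by
    intro m f' hf' x hx
    simpa using hG.smul_mem_cylinder (g := f') (by simpa using hf') hx
  obtain ⟨x₀, hx₀⟩ := cylinder_nonempty hf
  have hex : ∃ m, ∃ f' ∈ S.F m, x₀ ∈ S.cylinder m f' := ⟨n, f, hf, hx₀⟩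
  -- The earliest `X_m` that contains `x₀` gives the one piece that contains the whole cylinder
  -- `[f]_n`; all other summands vanish.
  set m := Nat.find hex with hm
  obtain ⟨f', hf', hx'⟩ := Nat.find_spec hex
  have hmn : m ≤ n := Nat.find_min' hex ⟨f, hf, hx₀⟩
  have hnew : New m f' := by
    refine ⟨hf', fun k hk f'' hf'' => ?_⟩
    rw [Set.disjoint_left]
    intro y hy hy'
    exact Nat.find_min hex hk ⟨f'', hf'', cylinder_subset_of_mem hk.le hy hy' hx'⟩
  rw [tsum_eq_single (m, f')]
  · rw [hM m f' hnew]
    obtain ⟨p, hp, rfl, hpx⟩ := mem_cylinder_iff.1 hx'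
    obtain rfl := hp.eq_of_mem_cylinder hpx hmn hx₀
    obtain ⟨q, hq, hqk⟩ := hp.exists_eq_mul
    have hmem : (p m) * q n ∈ S.F n := by rwa [hqk n hmn, mul_inv_cancel_left]
    have hset : (fun x => p m • x) ⁻¹' S.cylinder n (p n) ∩ S.cylinder m 1 =
        S.cylinder n (q n) := by
      have e : p n = p m * q n := by rw [hqk n hmn, mul_inv_cancel_left]
      have hsub : S.cylinder n (q n) ⊆ S.cylinder m 1 := by
        have := (hq.mono (Nat.zero_le m)).cylinder_subset hmn
        rwa [hqk m le_rfl, inv_mul_cancel] at this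
      ext x
      rw [mem_inter_iff, mem_preimage, e,
        hG.smul_mem_cylinder_iff (hq.mem_of_le (Nat.zero_le n)) hmem]
      exact ⟨fun h => h.1, fun h => ⟨h, hsub h⟩⟩
    rw [hset, hP q hq n]
    rfl
  · rintro ⟨k, f''⟩ hne
    by_cases hn : New k f''
    swap
    · simp [M, hn]
    rw [hM k f'' hn, ← nonpos_iff_eq_zero, ← measure_empty (μ := P)]
    refine measure_mono ?_
    rintro y ⟨hy, hy1⟩
    have hy2 := hsmul k f'' hn.1 y hy1
    have hy3 := cylinder_subset_of_mem hmn hx' hx₀ hy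
    rcases lt_trichotomy k m with h | h | h
    · exact Set.disjoint_left.1 (hnew.2 k h f'' hn.1) hy2 hy3
    · refine hne (Prod.ext h ?_)
      rw [h] at hy2
      exact eq_of_mem_cylinder hy2 hy3
    · exact Set.disjoint_left.1 (hn.2 m h f' hf') hy3 hy2

variable {ξ : Measure S.Space}

lemma CFWeights.IsCFMeasure.smulInvariantMeasure (hξ : (CFWeights.uniform S).IsCFMeasure ξ)
    (hA : S.Absorbing) (hG : S.IsCFAction) : SMulInvariantMeasure G S.Space ξ := by
  have := hG.continuousConstSMul hA
  refine ⟨fun g s hs => ?_⟩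
  have h := hξ.compMeasure_eq hA hG g⁻¹
  simp only [uniform_cocycle hA, ENNReal.coe_one] at h
  rw [show (fun _ : S.Space => (1 : ℝ≥0∞)) = 1 from rfl, withDensity_one] at h
  conv_rhs => rw [← h]
  rw [compMeasure, inv_inv, Measure.map_apply (continuous_const_smul g).measurable hs]

lemma CFWeights.IsCFMeasure.eq_smul_of_invariant (hξ : (CFWeights.uniform S).IsCFMeasure ξ)
    (hA : S.Absorbing) (hG : S.IsCFAction) {γ : Measure S.Space} (hγ : γ.Regular)
    (hinv : SMulInvariantMeasure G S.Space γ) :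
    γ = (γ (S.cylinder 0 1)).toNNReal • ξ := by
  have := hG.continuousConstSMul hA
  have h := hξ.eq_smul (γ := γ) fun n f hf => ?_
  · simpa [uniform] using h
  · have hf' : f * 1 ∈ S.F n := by rwa [mul_one]
    have h := hG.compMeasure_cylinder hA γ (S.one_mem_F n) hf'
    rw [mul_one] at h
    rw [← h, compMeasure, Measure.map_apply (continuous_const_smul _).measurable
      (measurableSet_cylinder n 1), hinv.measure_preimage_smul _ (measurableSet_cylinder n 1)]
    have : (CFWeights.uniform S).ν n f / (CFWeights.uniform S).ν n 1 = 1 :=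
      div_self ((CFWeights.uniform S).ν_pos n f hf).ne'
    rw [this, ENNReal.coe_one, one_mul]

theorem CFShape.isRadonUniquelyErgodic (hA : S.Absorbing) (hG : S.IsCFAction) :
    IsRadonUniquelyErgodic G S.Space := by
  obtain ⟨ξ, hξ⟩ := exists_isCFMeasure_uniform hA hG
  refine ⟨ξ, ?_, hξ.regular, hξ.smulInvariantMeasure hA hG,
    fun γ h1 h2 => ⟨_, hξ.eq_smul_of_invariant hA hG h1 h2⟩⟩
  rintro rfl
  have := hξ 0 1 (S.one_mem_F 0)
  simp [CFWeights.uniform] at this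

theorem CFShape.existsUnique_invariant (hA : S.Absorbing) (hG : S.IsCFAction) :
    ∃! ξ : Measure S.Space, ξ.Regular ∧ SMulInvariantMeasure G S.Space ξ ∧
      ξ (Set.range (S.point 0)) = 1 := by
  obtain ⟨ξ, hξ⟩ := exists_isCFMeasure_uniform hA hG
  refine ⟨ξ, ⟨hξ.regular, hξ.smulInvariantMeasure hA hG, ?_⟩, ?_⟩
  · rw [range_point_zero, hξ 0 1 (S.one_mem_F 0)]
    simp [CFWeights.uniform]
  · rintro γ ⟨h1, h2, h3⟩
    rw [range_point_zero] at h3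
    have := hξ.eq_smul_of_invariant hA hG h1 h2
    rwa [h3, ENNReal.toNNReal_one, one_smul] at this

end Action

end RankOne

namespace RankOne

/-! ### Standard Borel spaces and isomorphisms modulo null sets -/

lemma standardBorelSpace_of_measurableEquiv {X Y : Type*} [MeasurableSpace X] [MeasurableSpace Y]
    [StandardBorelSpace Y] (e : X ≃ᵐ Y) : StandardBorelSpace X := by
  let := upgradeStandardBorel Y
  let : TopologicalSpace X := TopologicalSpace.induced e inferInstance
  refine ⟨⟨inferInstance, ⟨?_⟩, e.toEquiv.polishSpace_induced⟩⟩
  rw [borel_comap, ← BorelSpace.measurable_eq (α := Y)]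
  exact e.measurableEmbedding.comap_eq.symm

/-- The space is σ-compact, hence Borel in its completion for a compatible metric, and that
completion is Polish. -/
lemma standardBorelSpace_of_locallyCompact {X : Type*} [TopologicalSpace X] [T2Space X]
    [LocallyCompactSpace X] [SecondCountableTopology X] [MeasurableSpace X] [BorelSpace X] :
    StandardBorelSpace X := by
  let : MetricSpace X := TopologicalSpace.metrizableSpaceMetric X
  let Y := UniformSpace.Completion X
  let : MeasurableSpace Y := borel Y
  have : BorelSpace Y := ⟨rfl⟩
  have hemb : IsEmbedding ((↑) : X → Y) :=
    (UniformSpace.Completion.isUniformEmbedding_coe X).isEmbedding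
  have hr : MeasurableSet (range ((↑) : X → Y)) := by
    rw [← image_univ, ← iUnion_compactCovering X, image_iUnion]
    exact MeasurableSet.iUnion fun n =>
      ((isCompact_compactCovering X n).image hemb.continuous).isClosed.measurableSet
  have : TopologicalSpace.SeparableSpace Y :=
    UniformSpace.Completion.denseRange_coe.separableSpace hemb.continuous
  have : StandardBorelSpace (range ((↑) : X → Y)) := hr.standardBorel
  exact standardBorelSpace_of_measurableEquiv (hemb.measurableEmbedding hr).equivRange

/-- Through `Ω ≅ ℝ × ℝ` the set splits into uncountably many disjoint uncountable Borel fibres, and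
an s-finite measure charges only countably many of them. -/
lemma exists_null_not_countable {Z : Type*} [MeasurableSpace Z] [StandardBorelSpace Z]
    (η : Measure Z) [SFinite η] {Ω : Set Z} (hΩ : MeasurableSet Ω) (hc : ¬ Ω.Countable) :
    ∃ N ⊆ Ω, MeasurableSet N ∧ η N = 0 ∧ ¬ N.Countable := by
  have := hΩ.standardBorel
  have hΩc : ¬ Countable Ω := fun h => hc (countable_coe_iff.1 h)
  have hR : ¬ Countable (ℝ × ℝ) := fun h => by
    have : Countable ℝ := Function.Injective.countable (Prod.mk_right_injective (0 : ℝ))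
    exact not_countable ‹Countable ℝ›
  let e : Ω ≃ᵐ ℝ × ℝ := PolishSpace.measurableEquivOfNotCountable hΩc hR
  let N : ℝ → Set Z := fun t => Subtype.val '' (e ⁻¹' ({t} ×ˢ univ))
  have hN : ∀ t, MeasurableSet (N t) := fun t =>
    hΩ.subtype_image (e.measurable ((measurableSet_singleton t).prod MeasurableSet.univ))
  have hdisj : Pairwise (Function.onFun Disjoint N) := by
    intro s t hst
    refine Set.disjoint_left.2 ?_
    rintro _ ⟨x, hx, rfl⟩ ⟨y, hy, hxy⟩
    obtain rfl := Subtype.ext hxy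
    exact hst (hx.1.symm.trans hy.1)
  obtain ⟨t, ht⟩ : ∃ t, t ∉ {t | 0 < η (N t)} := by
    by_contra! h
    have := Measure.countable_meas_pos_of_disjoint_iUnion (μ := η) hN hdisj
    rw [eq_univ_of_forall h] at this
    exact not_countable (countable_univ_iff.1 this)
  refine ⟨N t, by rintro _ ⟨x, -, rfl⟩; exact x.2, hN t, by simpa using ht, fun h => ?_⟩
  have hinj : Function.Injective fun s : ℝ => ((e.symm (t, s) : Ω) : Z) := fun a b hab => by
    have := e.symm.injective (Subtype.ext hab)
    exact (Prod.mk.inj this).2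
  have : (univ : Set ℝ).Countable := by
    refine Set.MapsTo.countable_of_injOn (f := fun s : ℝ => ((e.symm (t, s) : Ω) : Z)) (t := N t)
      ?_ hinj.injOn h
    intro s _
    exact ⟨e.symm (t, s), by simp, rfl⟩
  exact not_countable (countable_univ_iff.1 this)

/-- A measurable map that is injective on a conull set agrees a.e. with a Borel isomorphism. -/
theorem exists_measurableEquiv_ae_eq {Z X : Type*} [MeasurableSpace Z] [StandardBorelSpace Z]
    [MeasurableSpace X] [StandardBorelSpace X] (η : Measure Z) [SFinite η] {Ω : Set Z}
    (hΩ : MeasurableSet Ω) (hc : ¬ Ω.Countable) (hη : η Ωᶜ = 0) {φ : Z → X} (hφ : Measurable φ)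
    (hinj : InjOn φ Ω) : ∃ ψ : Z ≃ᵐ X, ∀ᵐ z ∂η, ψ z = φ z := by
  classical
  -- Sacrificing an uncountable null set `N` makes the complements of `D` and of its image both
  -- uncountable, so they are Borel isomorphic and `φ` on `D` extends to a bijection.
  obtain ⟨N, hNΩ, hN, hN0, hNc⟩ := exists_null_not_countable η hΩ hc
  set D := Ω \ N with hD
  have hDm : MeasurableSet D := hΩ.diff hN
  have hDinj : InjOn φ D := hinj.mono sdiff_subset
  have := hDm.standardBorel
  let f : D → X := fun x => φ x
  have hf : MeasurableEmbedding f :=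
    (hφ.comp measurable_subtype_coe).measurableEmbedding (injOn_iff_injective.1 hDinj)
  have hEm := hf.measurableSet_range
  have hDc : ¬ Countable ↥Dᶜ := fun h => by
    refine hNc ((countable_coe_iff.1 h).mono ?_)
    exact fun x hx hx' => hx'.2 hx
  have hEc : ¬ Countable ↥(range f)ᶜ := fun h => by
    refine hNc (Set.MapsTo.countable_of_injOn (f := φ) ?_ (hinj.mono hNΩ) (countable_coe_iff.1 h))
    rintro x hx ⟨y, hxy⟩
    exact y.2.2 (hinj y.2.1 (hNΩ hx) hxy ▸ hx)
  have := hDm.compl.standardBorel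
  have := hEm.standardBorel
  have := hEm.compl.standardBorel
  let e₂ : ↥Dᶜ ≃ᵐ ↥(range f)ᶜ := PolishSpace.measurableEquivOfNotCountable hDc hEc
  refine ⟨(MeasurableEquiv.sumCompl hDm).symm.trans
    ((MeasurableEquiv.sumCongr hf.equivRange e₂).trans (MeasurableEquiv.sumCompl hEm)), ?_⟩
  have hDae : ∀ᵐ z ∂η, z ∈ D := by
    refine measure_mono_null (fun z hz => ?_) (measure_union_null hη hN0)
    by_contra h
    simp only [mem_union, mem_compl_iff, not_or, not_not] at h
    exact hz ⟨h.1, h.2⟩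
  filter_upwards [hDae] with z hz
  have h1 : (MeasurableEquiv.sumCompl hDm).symm z = Sum.inl ⟨z, hz⟩ :=
    Equiv.Set.sumCompl_symm_apply_of_mem hz
  simp only [MeasurableEquiv.trans_apply, h1]
  change ((hf.equivRange ⟨z, hz⟩ : range f) : X) = φ z
  rw [hf.equivRange_apply]

end RankOne

namespace RankOne

/-! ### Towers of a rank-one action off an invariant null set -/

variable {G : Type*} [Group G] {Z : Type*} [MeasurableSpace Z] [MulAction G Z]

namespace QuasiInvariant

variable {η : Measure Z} (h : QuasiInvariant G η)
include h

lemma measurableConstSMul : MeasurableConstSMul G Z := ⟨fun g => (h g).measurable⟩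

lemma measure_smul_eq_zero {N : Set Z} (hN : η N = 0) (g : G) : η (g • N) = 0 := by
  rw [← Set.preimage_smul_inv]
  exact (h g⁻¹).preimage_null hN

lemma measure_smul_eq_zero_iff {N : Set Z} (g : G) : η (g • N) = 0 ↔ η N = 0 :=
  ⟨fun h' => by simpa using h.measure_smul_eq_zero h' g⁻¹, fun h' => h.measure_smul_eq_zero h' g⟩

lemma compMeasure_apply (g : G) {A : Set Z} (hA : MeasurableSet A) :
    compMeasure η g A = η (g • A) := by
  rw [compMeasure, Measure.map_apply (h g⁻¹).measurable hA]
  exact congrArg η (Set.preimage_smul_inv g A)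

end QuasiInvariant

lemma IsRokhlinTower.exists_scale {η : Measure Z} [SigmaFinite η] (hns : QuasiInvariant G η)
    {B : Set Z} {F : Finset G} (h : IsRokhlinTower η B F) {f : G} (hf : f ∈ F) :
    ∃ c : ℝ≥0, 0 < c ∧ ∀ A ⊆ B, MeasurableSet A → η (f • A) = c * η A := by
  obtain ⟨c, hc⟩ := h.const_rnDeriv f hf
  have hσ : SigmaFinite (compMeasure η f) := hns.sigmaFinite_compMeasure f
  have hA : ∀ A ⊆ B, MeasurableSet A → η (f • A) = c * η A := by
    intro A hAB hA
    rw [← hns.compMeasure_apply f hA,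
      ← Measure.setLIntegral_rnDeriv (show compMeasure η f ≪ η from (hns f⁻¹).absolutelyContinuous),
      lintegral_congr_ae (ae_restrict_of_ae_restrict_of_subset hAB hc), setLIntegral_const]
  -- The derivative of a σ-finite measure is a.e. finite, and `B` has positive measure.
  have hc_top : c ≠ ∞ := by
    rintro rfl
    have h1 : ∀ᵐ x ∂(η.restrict B), (compMeasure η f).rnDeriv η x < ∞ :=
      ae_restrict_of_ae (Measure.rnDeriv_lt_top _ _)
    have h2 : ∀ᵐ x ∂(η.restrict B), False := by
      filter_upwards [h1, hc] with x h1 h2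
      exact absurd h2 h1.ne
    rw [ae_iff] at h2
    simp only [not_false_eq_true, ofPred_true, Measure.restrict_apply_univ] at h2
    exact h.pos.ne' h2
  have hc0 : c ≠ 0 := by
    rintro rfl
    have := hA B Subset.rfl h.measurableSet
    rw [zero_mul, hns.measure_smul_eq_zero_iff] at this
    exact h.pos.ne' this
  refine ⟨c.toNNReal, ENNReal.toNNReal_pos hc0 hc_top, ?_⟩
  rwa [ENNReal.coe_toNNReal hc_top]

/-- Towers along `Q` whose defining properties hold exactly on an invariant conull set `Ω`. -/
structure ExactTowers (η : Measure Z) (Q : ℕ → Finset G) where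
  Ω : Set Z
  B : ℕ → Set Z
  measure_compl : η Ωᶜ = 0
  smul_mem : ∀ (g : G), ∀ x ∈ Ω, g • x ∈ Ω
  B_subset : ∀ n, B n ⊆ Ω
  measurableSet_B : ∀ n, MeasurableSet (B n)
  pos : ∀ n, 0 < η (B n)
  lt_top : ∀ n, η (B n) < ∞
  one_mem : ∀ n, 1 ∈ Q n
  Q_zero : Q 0 = {1}
  disjoint : ∀ n, ∀ f ∈ Q n, ∀ f' ∈ Q n, f ≠ f' → Disjoint (f • B n) (f' • B n)
  refinement : ∀ n, ∀ f ∈ Q n, ∃ S ⊆ Q (n + 1), f • B n = ⋃ h ∈ S, h • B (n + 1)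
  scale : ∀ n, ∀ f ∈ Q n, ∃ c : ℝ≥0, 0 < c ∧
    ∀ A ⊆ B n, MeasurableSet A → η (f • A) = c * η A
  eventually_mem : ∀ x ∈ Ω, ∀ g : G, ∀ᶠ n in atTop, ∃ f ∈ Q n, x ∈ f • B n ∧ g * f ∈ Q n
  separate : ∀ x ∈ Ω, ∀ y ∈ Ω, x ≠ y → ∃ n, ∃ f ∈ Q n, x ∈ f • B n ∧ y ∉ f • B n

/-- All exceptional points lie in a measurable null set. Its saturation is still null because `G` is
countable, and cutting the bases down to the invariant complement commutes with translation. -/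
theorem IsRankOneAlong.nonempty_exactTowers [Countable G] {η : Measure Z} [SigmaFinite η]
    (hns : QuasiInvariant G η) (hfree : FreeAE G η) {Q : ℕ → Finset G}
    (hQ : IsRankOneAlong η Q) : Nonempty (ExactTowers η Q) := by
  obtain ⟨hQ0, -, B, -, hB, href, ⟨X₀, hX₀, -, hsep⟩, horb⟩ := hQ
  choose! S hSQ hS using href
  have hae : ∀ᵐ x ∂η, (∀ n, ∀ f ∈ Q n, (x ∈ f • B n ↔ x ∈ ⋃ h ∈ S n f, h • B (n + 1))) ∧
      x ∈ X₀ ∧ (∀ g : G, ∀ᶠ n in atTop, g • x ∈ orbitPiece (B n) (Q n) x) ∧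
      ∀ g : G, g ≠ 1 → g • x ≠ x := by
    refine .and ?_ (hX₀.and (horb.and ?_))
    · refine ae_all_iff.2 fun n => ae_all_iff.2 fun f => ?_
      by_cases hf : f ∈ Q n
      · filter_upwards [hS n f hf] with x hx _
        exact iff_of_eq hx
      · exact .of_forall fun x h => absurd h hf
    · refine ae_all_iff.2 fun g => ?_
      by_cases hg : g = 1
      · exact .of_forall fun x h => absurd hg h
      · filter_upwards [hfree g hg] with x hx _ using hx
  set N := toMeasurable η {x | ¬ ((∀ n, ∀ f ∈ Q n, (x ∈ f • B n ↔
      x ∈ ⋃ h ∈ S n f, h • B (n + 1))) ∧ x ∈ X₀ ∧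
      (∀ g : G, ∀ᶠ n in atTop, g • x ∈ orbitPiece (B n) (Q n) x) ∧
      ∀ g : G, g ≠ 1 → g • x ≠ x)} with hN
  have hN0 : η N = 0 := by rw [hN, measure_toMeasurable]; exact hae
  have hNm : MeasurableSet N := measurableSet_toMeasurable _ _
  have hNP : ∀ x, x ∉ N → (∀ n, ∀ f ∈ Q n, (x ∈ f • B n ↔
      x ∈ ⋃ h ∈ S n f, h • B (n + 1))) ∧ x ∈ X₀ ∧
      (∀ g : G, ∀ᶠ n in atTop, g • x ∈ orbitPiece (B n) (Q n) x) ∧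
      ∀ g : G, g ≠ 1 → g • x ≠ x := fun x hx => by
    by_contra h
    exact hx (subset_toMeasurable _ _ h)
  clear_value N
  let Ω : Set Z := {x | ∀ g : G, g • x ∉ N}
  have hΩN : ∀ x ∈ Ω, x ∉ N := fun x hx => by simpa using hx 1
  have hΩsmul : ∀ (g : G), ∀ x ∈ Ω, g • x ∈ Ω := fun g x hx g' => by
    rw [← mul_smul]
    exact hx _
  have hΩc : Ωᶜ = ⋃ g : G, (fun x : Z => g • x) ⁻¹' N := by
    ext x
    simp [Ω]
  have hmeas : MeasurableSet Ωᶜ := by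
    rw [hΩc]
    exact MeasurableSet.iUnion fun g => (hns g).measurable hNm
  have hnull : η Ωᶜ = 0 := by
    rw [hΩc]
    exact measure_iUnion_null fun g => (hns g).preimage_null hN0
  have hmem : ∀ (f : G) (A : Set Z) (x : Z), x ∈ f • (A ∩ Ω) ↔ x ∈ f • A ∧ x ∈ Ω := by
    intro f A x
    rw [mem_smul_set_iff_inv_smul_mem, mem_smul_set_iff_inv_smul_mem]
    refine and_congr_right fun _ => ⟨fun h => ?_, hΩsmul _ x⟩
    simpa using hΩsmul f _ h
  have hBΩ : ∀ n, η (B n ∩ Ω) = η (B n) := fun n =>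
    measure_inter_conull hnull
  exact ⟨{
    Ω := Ω
    B := fun n => B n ∩ Ω
    measure_compl := hnull
    smul_mem := hΩsmul
    B_subset := fun n => inter_subset_right
    measurableSet_B := fun n => (hB n).measurableSet.inter hmeas.of_compl
    pos := fun n => by rw [hBΩ]; exact (hB n).pos
    lt_top := fun n => by rw [hBΩ]; exact (hB n).lt_top
    one_mem := fun n => (hB n).one_mem
    Q_zero := hQ0
    disjoint := fun n f hf f' hf' hne => ((hB n).disjoint f hf f' hf' hne).mono
      (smul_set_mono inter_subset_left) (smul_set_mono inter_subset_left)
    refinement := fun n f hf => by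
      refine ⟨S n f, hSQ n f hf, ?_⟩
      ext x
      simp only [hmem, mem_iUnion, exists_prop]
      constructor
      · rintro ⟨h1, h2⟩
        have := ((hNP x (hΩN x h2)).1 n f hf).1 h1
        simp only [mem_iUnion, exists_prop] at this
        obtain ⟨h, hh, hx⟩ := this
        exact ⟨h, hh, hx, h2⟩
      · rintro ⟨h, hh, hx, h2⟩
        refine ⟨((hNP x (hΩN x h2)).1 n f hf).2 ?_, h2⟩
        exact mem_biUnion hh hx
    scale := fun n f hf => by
      obtain ⟨c, hc, h⟩ := (hB n).exists_scale hns hf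
      exact ⟨c, hc, fun A hA => h A (hA.trans inter_subset_left)⟩
    eventually_mem := fun x hx g => by
      obtain ⟨-, -, h3, h4⟩ := hNP x (hΩN x hx)
      filter_upwards [h3 g] with n hn
      obtain ⟨f, hf, hxf, k, hk, hgk⟩ := hn
      refine ⟨f, hf, (hmem _ _ _).2 ⟨hxf, hx⟩, ?_⟩
      -- From `g x = k f⁻¹ x` and freeness, `g = k f⁻¹`, so `g f = k ∈ Q n`: convergence of orbit
      -- pieces becomes a statement inside `G`.
      have : (k * f⁻¹)⁻¹ * g = 1 := by
        by_contra hne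
        exact h4 _ hne (by rw [mul_smul, hgk, inv_smul_smul])
      rw [inv_mul_eq_one] at this
      rwa [← this, inv_mul_cancel_right]
    separate := fun x hx y hy hne => by
      obtain ⟨n, f, hf, h1, h2⟩ := hsep x (hNP x (hΩN x hx)).2.1 y (hNP y (hΩN y hy)).2.1 hne
      exact ⟨n, f, hf, (hmem _ _ _).2 ⟨h1, hx⟩, fun h => h2 ((hmem _ _ _).1 h).1⟩ }⟩

namespace ExactTowers

variable {η : Measure Z} {Q : ℕ → Finset G} (T : ExactTowers η Q)

lemma eq_of_mem {n : ℕ} {f f' : G} (hf : f ∈ Q n) (hf' : f' ∈ Q n) {x : Z}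
    (h : x ∈ f • T.B n) (h' : x ∈ f' • T.B n) : f = f' := by
  by_contra hne
  exact Set.disjoint_left.1 (T.disjoint n f hf f' hf' hne) h h'

lemma exists_refinement {n m : ℕ} (hnm : n ≤ m) {f : G} (hf : f ∈ Q n) :
    ∃ S ⊆ Q m, f • T.B n = ⋃ h ∈ S, h • T.B m := by
  classical
  induction m, hnm using Nat.le_induction with
  | base => exact ⟨{f}, by simpa using hf, by simp⟩
  | succ m _ ih =>
    obtain ⟨S, hS, h⟩ := ih
    choose! R hR hR' using T.refinement m
    refine ⟨S.biUnion R, Finset.biUnion_subset.2 fun a ha => hR a (hS ha), ?_⟩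
    rw [h, Finset.set_biUnion_biUnion]
    exact iUnion₂_congr fun a ha => hR' a (hS ha)

lemma level_subset {n m : ℕ} (hnm : n ≤ m) {f h : G} (hf : f ∈ Q n) (hh : h ∈ Q m) {x : Z}
    (hx : x ∈ f • T.B n) (hx' : x ∈ h • T.B m) : h • T.B m ⊆ f • T.B n := by
  obtain ⟨S, hS, e⟩ := T.exists_refinement hnm hf
  rw [e] at hx ⊢
  simp only [mem_iUnion, exists_prop] at hx
  obtain ⟨h', hh', hxh'⟩ := hx
  obtain rfl := T.eq_of_mem hh (hS hh') hx' hxh'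
  exact subset_biUnion_of_mem (u := fun h => h • T.B m) hh'

lemma level_subset_Ω (n : ℕ) (f : G) : f • T.B n ⊆ T.Ω := by
  rintro _ ⟨x, hx, rfl⟩
  exact T.smul_mem f x (T.B_subset n hx)

lemma level_pos (hns : QuasiInvariant G η) (n : ℕ) (f : G) : 0 < η (f • T.B n) :=
  pos_iff_ne_zero.2 fun h => (T.pos n).ne' ((hns.measure_smul_eq_zero_iff f).1 h)

lemma level_lt_top {n : ℕ} {f : G} (hf : f ∈ Q n) : η (f • T.B n) < ∞ := by
  obtain ⟨c, -, h⟩ := T.scale n f hf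
  rw [h _ Subset.rfl (T.measurableSet_B n)]
  exact ENNReal.mul_lt_top ENNReal.coe_lt_top (T.lt_top n)

lemma eventually_separate {x y : Z} (hx : x ∈ T.Ω) (hy : y ∈ T.Ω) (hne : x ≠ y) :
    ∀ᶠ n in atTop, ∀ f ∈ Q n, x ∈ f • T.B n → y ∉ f • T.B n := by
  obtain ⟨m, f, hf, h1, h2⟩ := T.separate x hx y hy hne
  filter_upwards [eventually_ge_atTop m] with n hn h hh h3 h4
  exact h2 (T.level_subset hn hf hh h1 h3 h4)

/-- Most of a level `z B_l` is filled by levels of a later tower from which the translates by a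
given finite set do not leave that tower. -/
lemma exists_next (hns : QuasiInvariant G η) [NullSingletonClass η] {l : ℕ} {z : G} (hz : z ∈ Q l)
    (K : Finset G) {ε : ℝ≥0∞} (hε : ε ≠ 0) :
    ∃ l' > l, ∃ S ⊆ Q l', 1 < S.card ∧ (∀ q ∈ S, q • T.B l' ⊆ z • T.B l) ∧
      (∀ q ∈ S, ∀ k ∈ K, ∀ f ∈ Q l, k * (f * z⁻¹ * q) ∈ Q l') ∧
      η (z • T.B l \ ⋃ q ∈ S, q • T.B l') ≤ ε * η (z • T.B l) := by
  classical
  have := hns.measurableConstSMul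
  set A := z • T.B l with hA
  have hAm : MeasurableSet A := (T.measurableSet_B l).const_smul z
  -- The future base point does not enter the condition, so any element of the chosen set may later
  -- serve as the next `z`.
  let S : ℕ → Finset G := fun n => {q ∈ Q n | q • T.B n ⊆ A ∧
    ∀ k ∈ K, ∀ f ∈ Q l, k * (f * z⁻¹ * q) ∈ Q n}
  let E : ℕ → Set Z := fun n => ⋃ q ∈ S n, q • T.B n
  have hEm : ∀ n, MeasurableSet (E n) := fun n =>
    Finset.measurableSet_biUnion _ fun q _ => (T.measurableSet_B n).const_smul q
  -- Only the finitely many elements `k f z⁻¹` have to keep the orbit of `x` inside the tower, so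
  -- one `n` serves all of them.
  have hE : ∀ x ∈ A, ∀ᶠ n in atTop, ∃ q ∈ S n, x ∈ q • T.B n := by
    intro x hx
    have hxΩ := T.level_subset_Ω l z hx
    have h1 : ∀ᶠ n in atTop, ∀ k ∈ K, ∀ f ∈ Q l, ∃ q ∈ Q n, x ∈ q • T.B n ∧
        k * (f * z⁻¹) * q ∈ Q n :=
      (Filter.eventually_all_finset K).2 fun k _ => (Filter.eventually_all_finset (Q l)).2
        fun f _ => T.eventually_mem x hxΩ (k * (f * z⁻¹))
    filter_upwards [h1, T.eventually_mem x hxΩ 1, eventually_ge_atTop l] with n h1 h2 hn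
    obtain ⟨q, hq, hxq, -⟩ := h2
    refine ⟨q, Finset.mem_filter.2 ⟨hq, T.level_subset hn hz hq hx hxq, fun k hk f hf => ?_⟩, hxq⟩
    obtain ⟨q', hq', hxq', h⟩ := h1 k hk f hf
    obtain rfl := T.eq_of_mem hq hq' hxq hxq'
    rwa [mul_assoc] at h
  have hpos := T.level_pos hns l z
  have htop := T.level_lt_top hz
  have hloss : ∀ᶠ n in atTop, η (A \ E n) ≤ ε * η A := by
    have : IsFiniteMeasure (η.restrict A) := ⟨by simpa using htop⟩
    have ht := tendsto_measure_of_ae_tendsto_indicator_of_isFiniteMeasure (μ := η.restrict A)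
      atTop (A := ∅) (As := fun n => A \ E n) MeasurableSet.empty (fun n => hAm.diff (hEm n))
      (by
        filter_upwards [ae_restrict_mem hAm] with x hx
        filter_upwards [hE x hx] with n hn
        obtain ⟨q, hq, hxq⟩ := hn
        simp only [Set.mem_sdiff, mem_empty_iff_false, iff_false, not_and, not_not]
        exact fun _ => mem_biUnion hq hxq)
    rw [measure_empty] at ht
    have hlt : 0 < ε * η A := ENNReal.mul_pos hε hpos.ne'
    filter_upwards [ht.eventually_lt_const hlt] with n hn
    rw [Measure.restrict_apply (hAm.diff (hEm n)), inter_eq_left.2 sdiff_subset] at hn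
    exact hn.le
  -- As `η` has no atoms, `A` contains two points, and these eventually lie in different levels.
  have hcard : ∀ᶠ n in atTop, 1 < (S n).card := by
    have hns' : ¬ A.Subsingleton := fun h => hpos.ne' (h.measure_zero η)
    obtain ⟨x, hx, y, hy, hne⟩ := Set.not_subsingleton_iff.1 hns'
    filter_upwards [hE x hx, hE y hy, T.eventually_separate (T.level_subset_Ω l z hx)
      (T.level_subset_Ω l z hy) hne] with n ⟨q, hq, hxq⟩ ⟨q', hq', hyq⟩ h3
    refine Finset.one_lt_card.2 ⟨q, hq, q', hq', ?_⟩
    rintro rfl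
    exact h3 q (Finset.mem_filter.1 hq).1 hxq hyq
  obtain ⟨n, h1, h2, h3⟩ := (hloss.and (hcard.and (eventually_gt_atTop l))).exists
  exact ⟨n, h3, S n, Finset.filter_subset _ _, h2, fun q hq => (Finset.mem_filter.1 hq).2.1,
    fun q hq => (Finset.mem_filter.1 hq).2.2, h1⟩

end ExactTowers

end RankOne

/-! ### Extraction of `(C,F)`-shapes from a sparse sequence of towers. -/

namespace RankOne

variable {G : Type*} [Group G] {Z : Type*} [MeasurableSpace Z] [MulAction G Z]

/-- Towers `(A n, F n)` along the shapes of a `(C,F)`-construction: the levels `c A_{n+1}`,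
`c ∈ C_{n+1}`, are contained in `A n` and fill all but a summable proportion of it. -/
structure CFTowers (η : Measure Z) (S : CFShape G) where
  Ω : Set Z
  A : ℕ → Set Z
  measure_compl : η Ωᶜ = 0
  smul_mem : ∀ (g : G), ∀ x ∈ Ω, g • x ∈ Ω
  A_subset : ∀ n, A n ⊆ Ω
  measurableSet_A : ∀ n, MeasurableSet (A n)
  pos : ∀ n, 0 < η (A n)
  level_lt_top : ∀ n, ∀ f ∈ S.F n, η (f • A n) < ∞
  eq_of_mem : ∀ n, ∀ f ∈ S.F n, ∀ f' ∈ S.F n, ∀ x, x ∈ f • A n → x ∈ f' • A n → f = f'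
  scale : ∀ n, ∀ f ∈ S.F n, ∃ c : ℝ≥0, ∀ E ⊆ A n, MeasurableSet E → η (f • E) = c * η E
  refinement : ∀ n m, n ≤ m → ∀ f ∈ S.F n, ∃ H ⊆ S.F m, f • A n = ⋃ h ∈ H, h • A m
  subset : ∀ n, ∀ c ∈ S.C (n + 1), c • A (n + 1) ⊆ A n
  loss : ∀ n, η (A n \ ⋃ c ∈ S.C (n + 1), c • A (n + 1)) ≤ 2⁻¹ ^ n * η (A n)
  eventually_mul_mem : ∀ g : G, ∀ᶠ n in atTop, ∀ f ∈ S.F n, ∀ c ∈ S.C (n + 1),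
    g * (f * c) ∈ S.F (n + 1)
  eventually_mem : ∀ x ∈ Ω, ∀ᶠ n in atTop, ∃ f ∈ S.F n, x ∈ f • A n
  eventually_separate : ∀ x ∈ Ω, ∀ y ∈ Ω, x ≠ y → ∀ᶠ n in atTop, ∀ f ∈ S.F n,
    x ∈ f • A n → y ∉ f • A n

/-- The state of the recursion is a tower index `l` with a level `z ∈ Q l`. Given the next set `R`
of levels, the new `z'` is any element of `R`; with `F = Q_l z⁻¹` and `C = R z'⁻¹` both sets contain
`1`. -/
theorem ExactTowers.exists_CFTowers [Countable G] {η : Measure Z} {Q : ℕ → Finset G}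
    (T : ExactTowers η Q) (hns : QuasiInvariant G η) [NullSingletonClass η] :
    ∃ (S : CFShape G) (_ : CFTowers η S) (z : ℕ → G) (l : ℕ → ℕ), (∀ n, z n ∈ Q n) ∧
      StrictMono l ∧
      ∀ n, (S.F n : Set G) = (fun q => q * (z (l n))⁻¹) '' (Q (l n) : Set G) := by
  classical
  have := hns.measurableConstSMul
  obtain ⟨e, he⟩ := exists_surjective_nat G
  -- The element `1` yields `F_n C_{n+1} ⊆ F_{n+1}`; the exhaustion of `G` by the sets `K n` yields
  -- absorption.
  let K : ℕ → Finset G := fun n => insert 1 ((Finset.range (n + 1)).image e)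
  have hstep : ∀ (n : ℕ) (s : {s : ℕ × G // s.2 ∈ Q s.1}), ∃ (l' : ℕ) (R : Finset G),
      s.1.1 < l' ∧ R ⊆ Q l' ∧ 1 < R.card ∧ (∀ q ∈ R, q • T.B l' ⊆ s.1.2 • T.B s.1.1) ∧
      (∀ q ∈ R, ∀ k ∈ K n, ∀ f ∈ Q s.1.1, k * (f * s.1.2⁻¹ * q) ∈ Q l') ∧
      η (s.1.2 • T.B s.1.1 \ ⋃ q ∈ R, q • T.B l') ≤ 2⁻¹ ^ n * η (s.1.2 • T.B s.1.1) := by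
    intro n s
    obtain ⟨l', h, R, h'⟩ := T.exists_next hns s.2 (K n) (ε := 2⁻¹ ^ n)
      (pow_ne_zero _ (ENNReal.inv_ne_zero.2 ENNReal.ofNat_ne_top))
    exact ⟨l', R, h, h'⟩
  choose L R hL hRQ hcard hsub hmul hloss using hstep
  have hRne : ∀ n s, (R n s).Nonempty := fun n s =>
    Finset.card_pos.1 (zero_lt_one.trans (hcard n s))
  let st : ℕ → {s : ℕ × G // s.2 ∈ Q s.1} := fun n => Nat.rec
    -- Starting at the trivial tower `Q 0 = {1}` makes `F_0 = {1}`.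
    ⟨(0, 1), T.one_mem 0⟩ (fun n s => ⟨(L n s, (hRne n s).choose),
      hRQ n s (hRne n s).choose_spec⟩) n
  let l : ℕ → ℕ := fun n => (st n).1.1
  let z : ℕ → G := fun n => (st n).1.2
  let S' : ℕ → Finset G := fun n => R n (st n)
  have hzQ : ∀ n, z n ∈ Q (l n) := fun n => (st n).2
  have hzS : ∀ n, z (n + 1) ∈ S' n := fun n => (hRne n (st n)).choose_spec
  have hScard : ∀ n, 1 < (S' n).card := fun n => hcard n (st n)
  have hl : StrictMono l := strictMono_nat_of_lt_succ fun n => hL n (st n)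
  have hSsub : ∀ n, ∀ q ∈ S' n, q • T.B (l (n + 1)) ⊆ z n • T.B (l n) := fun n => hsub n (st n)
  have hSmul : ∀ n, ∀ q ∈ S' n, ∀ k ∈ K n, ∀ f ∈ Q (l n), k * (f * (z n)⁻¹ * q) ∈ Q (l (n + 1)) :=
    fun n => hmul n (st n)
  have hSloss : ∀ n, η (z n • T.B (l n) \ ⋃ q ∈ S' n, q • T.B (l (n + 1))) ≤
      2⁻¹ ^ n * η (z n • T.B (l n)) := fun n => hloss n (st n)
  have hl0 : l 0 = 0 := rfl
  have hz0 : z 0 = 1 := rfl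
  clear_value l z S'
  let F : ℕ → Finset G := fun n => (Q (l n)).image fun q => q * (z n)⁻¹
  let C : ℕ → Finset G := fun n =>
    Nat.rec {1} (fun n _ => (S' n).image fun q => q * (z (n + 1))⁻¹) n
  let A : ℕ → Set Z := fun n => z n • T.B (l n)
  have hmemF : ∀ n f, f ∈ F n ↔ f * z n ∈ Q (l n) := by
    intro n f
    simp only [F, Finset.mem_image]
    exact ⟨by rintro ⟨q, hq, rfl⟩; simpa using hq, fun h => ⟨_, h, by simp⟩⟩
  have hmemC : ∀ n c, c ∈ C (n + 1) ↔ c * z (n + 1) ∈ S' n := by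
    intro n c
    simp only [C, Finset.mem_image]
    exact ⟨by rintro ⟨q, hq, rfl⟩; simpa using hq, fun h => ⟨_, h, by simp⟩⟩
  have hlevel : ∀ n f, f • A n = (f * z n) • T.B (l n) := fun n f => (mul_smul _ _ _).symm
  have hKmul : ∀ n, ∀ g ∈ K n, ∀ f ∈ F n, ∀ c ∈ C (n + 1), g * (f * c) ∈ F (n + 1) := by
    intro n g hg f hf c hc
    rw [hmemF] at hf ⊢
    rw [hmemC] at hc
    simpa [mul_assoc] using hSmul n _ hc g hg _ hf
  have hCsub : ∀ n, ∀ c ∈ C (n + 1), c • A (n + 1) ⊆ A n := fun n c hc => by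
    rw [hlevel]
    exact hSsub n _ ((hmemC n c).1 hc)
  have hAne : ∀ n, (A n).Nonempty := fun n =>
    nonempty_of_measure_ne_zero (T.level_pos hns (l n) (z n)).ne'
  have hAeq : ∀ n, ∀ f ∈ F n, ∀ f' ∈ F n, ∀ x, x ∈ f • A n → x ∈ f' • A n → f = f' := by
    intro n f hf f' hf' x hx hx'
    rw [hlevel] at hx hx'
    exact mul_right_cancel (T.eq_of_mem ((hmemF n f).1 hf) ((hmemF n f').1 hf') hx hx')
  let S : CFShape G :=
    { F := F
      C := C
      F_zero := by
        simp only [F]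
        rw [hl0, T.Q_zero, hz0, Finset.image_singleton, inv_one, mul_one]
      one_mem_F := fun n => (hmemF n 1).2 (by simpa using hzQ n)
      one_mem_C := fun n hn => by
        obtain ⟨n, rfl⟩ : ∃ k, n = k + 1 := ⟨n - 1, by omega⟩
        exact (hmemC n 1).2 (by simpa using hzS n)
      one_lt_card_C := fun n hn => by
        obtain ⟨n, rfl⟩ : ∃ k, n = k + 1 := ⟨n - 1, by omega⟩
        simp only [C]
        rw [Finset.card_image_of_injective _ (mul_left_injective _)]
        exact hScard n
      mul_mem := fun n f hf c hc => by
        simpa using hKmul n 1 (Finset.mem_insert_self _ _) f hf c hc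
      disjoint := fun n c hc c' hc' hne f hf f' hf' heq => by
        -- If `f c = f' c'`, a point of `f c A_{n+1}` lies in both `f A_n` and `f' A_n`, so `f =
        -- f'`.
        obtain ⟨x, hx⟩ := (hAne (n + 1)).smul_set (a := f * c)
        have h1 : x ∈ f • A n := smul_set_mono (hCsub n c hc) (by rwa [← mul_smul])
        have h2 : x ∈ f' • A n :=
          smul_set_mono (hCsub n c' hc') (by rwa [← mul_smul, ← heq])
        obtain rfl := hAeq n f hf f' hf' x h1 h2
        exact hne (mul_left_cancel heq) }
  refine ⟨S,
    { Ω := T.Ω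
      A := A
      measure_compl := T.measure_compl
      smul_mem := T.smul_mem
      A_subset := fun n => T.level_subset_Ω _ _
      measurableSet_A := fun n => (T.measurableSet_B _).const_smul _
      pos := fun n => T.level_pos hns _ _
      level_lt_top := fun n f hf => by
        rw [hlevel]
        exact T.level_lt_top ((hmemF n f).1 hf)
      eq_of_mem := hAeq
      scale := fun n f hf => by
        obtain ⟨a, ha, h1⟩ := T.scale (l n) _ (hzQ n)
        obtain ⟨b, -, h2⟩ := T.scale (l n) _ ((hmemF n f).1 hf)
        -- The original towers scale relative to `B_l`; the new base is `z B_l`, so the constant of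
        -- `z` is divided out.
        refine ⟨b / a, fun E hE hEm => ?_⟩
        have hE' : (z n)⁻¹ • E ⊆ T.B (l n) := by
          rw [Set.smul_set_subset_iff_subset_inv_smul_set, inv_inv]
          exact hE
        have hEm' : MeasurableSet ((z n)⁻¹ • E) := hEm.const_smul _
        have e1 : E = z n • (z n)⁻¹ • E := (smul_inv_smul _ _).symm
        have e2 : f • E = (f * z n) • (z n)⁻¹ • E := by rw [mul_smul, smul_inv_smul]
        rw [e2, h2 _ hE' hEm']
        conv_rhs => rw [e1, h1 _ hE' hEm']
        rw [← mul_assoc, ← ENNReal.coe_mul, div_mul_cancel₀ _ ha.ne']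
      refinement := fun n m hnm f hf => by
        obtain ⟨H, hH, e⟩ := T.exists_refinement (hl.monotone hnm) ((hmemF n f).1 hf)
        refine ⟨H.image fun q => q * (z m)⁻¹, Finset.image_subset_image hH, ?_⟩
        rw [hlevel, e, Finset.set_biUnion_finset_image]
        simp only [hlevel, inv_mul_cancel_right]
      subset := hCsub
      loss := fun n => by
        have e : ⋃ c ∈ C (n + 1), c • A (n + 1) = ⋃ q ∈ S' n, q • T.B (l (n + 1)) := by
          simp only [C]
          rw [Finset.set_biUnion_finset_image]
          simp only [hlevel, inv_mul_cancel_right]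
        change η (A n \ ⋃ c ∈ C (n + 1), c • A (n + 1)) ≤ _
        rw [e]
        exact hSloss n
      eventually_mul_mem := fun g => by
        obtain ⟨i, rfl⟩ := he g
        filter_upwards [eventually_ge_atTop i] with n hn
        refine hKmul n _ (Finset.mem_insert_of_mem (Finset.mem_image_of_mem _ ?_))
        exact Finset.mem_range.2 (by omega)
      eventually_mem := fun x hx => by
        filter_upwards [hl.tendsto_atTop.eventually (T.eventually_mem x hx 1)] with n hn
        obtain ⟨q, hq, hxq, -⟩ := hn
        refine ⟨q * (z n)⁻¹, (hmemF _ _).2 (by simpa using hq), ?_⟩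
        rw [hlevel]
        simpa using hxq
      eventually_separate := fun x hx y hy hne => by
        filter_upwards [hl.tendsto_atTop.eventually (T.eventually_separate hx hy hne)]
          with n hn f hf
        rw [hlevel]
        -- The base points must be indexed by the original towers: `z n` is placed at index `l n`,
        -- and `1` at the indices that were skipped.
        exact hn _ ((hmemF n f).1 hf) }, Function.extend l z fun _ => 1, l, ?_, hl, fun n => ?_⟩
  · intro m
    by_cases h : ∃ n, l n = m
    · obtain ⟨n, rfl⟩ := h
      rw [hl.injective.extend_apply]
      exact hzQ n
    · rw [Function.extend_apply' _ _ _ h]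
      exact T.one_mem m
  · rw [hl.injective.extend_apply]
    exact Finset.coe_image

end RankOne

namespace RankOne

open CFShape

variable {G : Type*} [Group G] {Z : Type*} [MeasurableSpace Z] [MulAction G Z]

namespace CFTowers

variable {η : Measure Z} {S : CFShape G} (T : CFTowers η S)

/-! ### The coding of points by the towers -/

/-- The sequence `p` codes the point `x` from `n` on: `x` lies in the level `p_k A_k`, `k ≥ n`. -/
structure Codes (n : ℕ) (p : ℕ → G) (x : Z) : Prop where
  valid : S.Valid n p
  mem : ∀ k, n ≤ k → x ∈ p k • T.A k

/-- The set of points of `f A_n` that stay in the levels `h c A_{k+1}`, `h ∈ F_k`,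
`c ∈ C_{k+1}`, for all `k ≥ n`. -/
def core (n : ℕ) (f : G) : Set Z :=
  f • T.A n ∩ ⋂ k ≥ n, ⋃ h ∈ S.F k, ⋃ c ∈ S.C (k + 1), (h * c) • T.A (k + 1)

/-- The set of all points that are coded by some sequence. -/
def coded : Set Z := ⋃ n, ⋃ f ∈ S.F n, T.core n f

variable {T}

lemma smul_subset {n : ℕ} {f c : G} (hc : c ∈ S.C (n + 1)) :
    (f * c) • T.A (n + 1) ⊆ f • T.A n := by
  rw [mul_smul]
  exact smul_set_mono (T.subset n c hc)

lemma Codes.mono {n m : ℕ} {p : ℕ → G} {x : Z} (h : T.Codes n p x) (hnm : n ≤ m) :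
    T.Codes m p x := ⟨h.valid.mono hnm, fun k hk => h.mem k (hnm.trans hk)⟩

lemma Codes.of_eventually {n : ℕ} {p : ℕ → G} {x : Z} (hp : S.Valid n p)
    (h : ∀ᶠ k in atTop, x ∈ p k • T.A k) : T.Codes n p x := by
  refine ⟨hp, fun k hk => ?_⟩
  obtain ⟨N, hN, hkN⟩ := (h.and (eventually_ge_atTop k)).exists
  induction N, hkN using Nat.le_induction with
  | base => exact hN
  | succ N hkN ih =>
    refine ih ?_
    have := smul_subset (T := T) (f := p N) (hp.step N (hk.trans hkN))
    rw [mul_inv_cancel_left] at this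
    exact this hN

lemma Codes.eq {n m : ℕ} {p q : ℕ → G} {x : Z} (hp : T.Codes n p x) (hq : T.Codes m q x) {k : ℕ}
    (hn : n ≤ k) (hm : m ≤ k) : p k = q k :=
  T.eq_of_mem k _ (hp.valid.mem_of_le hn) _ (hq.valid.mem_of_le hm) x (hp.mem k hn) (hq.mem k hm)

lemma mem_core_iff {n : ℕ} {f : G} (hf : f ∈ S.F n) {x : Z} :
    x ∈ T.core n f ↔ ∃ p, T.Codes n p x ∧ p n = f := by
  simp only [core, mem_inter_iff, mem_iInter, mem_iUnion, exists_prop]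
  constructor
  · rintro ⟨h1, h2⟩
    choose! h hh c hc hx using h2
    have hmem : ∀ k, n ≤ k → x ∈ h k • T.A k := fun k hk => smul_subset (hc k hk) (hx k hk)
    -- The independently chosen levels fit together because `x` lies in only one level of tower `k +
    -- 1`.
    have hstep : ∀ k, n ≤ k → h (k + 1) = h k * c k := fun k hk =>
      T.eq_of_mem (k + 1) _ (hh _ (by omega)) _ (S.mul_mem k _ (hh k hk) _ (hc k hk)) x
        (hmem (k + 1) (by omega)) (hx k hk)
    refine ⟨h, ⟨⟨hh n le_rfl, fun k hk => ?_⟩, hmem⟩,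
      T.eq_of_mem n _ (hh n le_rfl) _ hf x (hmem n le_rfl) h1⟩
    rw [hstep k hk, inv_mul_cancel_left]
    exact hc k hk
  · rintro ⟨p, hp, rfl⟩
    refine ⟨hp.mem n le_rfl, fun k hk => ⟨p k, hp.valid.mem_of_le hk, _, hp.valid.step k hk, ?_⟩⟩
    rw [mul_inv_cancel_left]
    exact hp.mem (k + 1) (by omega)

lemma mem_coded_iff {x : Z} : x ∈ T.coded ↔ ∃ n p, T.Codes n p x := by
  simp only [coded, mem_iUnion, exists_prop]
  constructor
  · rintro ⟨n, f, hf, hx⟩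
    obtain ⟨p, hp, -⟩ := (mem_core_iff hf).1 hx
    exact ⟨n, p, hp⟩
  · rintro ⟨n, p, hp⟩
    exact ⟨n, p n, hp.valid.mem, (mem_core_iff hp.valid.mem).2 ⟨p, hp, rfl⟩⟩

lemma core_subset_coded {n : ℕ} {f : G} (hf : f ∈ S.F n) : T.core n f ⊆ T.coded := fun x hx => by
  obtain ⟨p, hp, -⟩ := (mem_core_iff hf).1 hx
  exact mem_coded_iff.2 ⟨n, p, hp⟩

lemma core_subset_level {n : ℕ} {f : G} : T.core n f ⊆ f • T.A n := inter_subset_left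

lemma Codes.mem_Ω {n : ℕ} {p : ℕ → G} {x : Z} (hp : T.Codes n p x) : x ∈ T.Ω := by
  obtain ⟨y, hy, rfl⟩ := hp.mem n le_rfl
  exact T.smul_mem _ y (T.A_subset n hy)

lemma Codes.smul {n : ℕ} {p : ℕ → G} {x : Z} (hp : T.Codes n p x) {g : G}
    (hg : g * p n ∈ S.F n) : T.Codes n (fun k => g * p k) (g • x) :=
  ⟨hp.valid.const_mul hg, fun k hk => by
    rw [mul_smul]
    exact smul_mem_smul_set (hp.mem k hk)⟩

lemma Codes.exists_smul {n : ℕ} {p : ℕ → G} {x : Z} (hp : T.Codes n p x) (g : G) :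
    ∃ m ≥ n, T.Codes m (fun k => g * p k) (g • x) := by
  obtain ⟨k, hk, hn⟩ := ((T.eventually_mul_mem g).and (eventually_ge_atTop n)).exists
  have := hk _ (hp.valid.mem_of_le hn) _ (hp.valid.step k hn)
  rw [mul_inv_cancel_left] at this
  exact ⟨k + 1, by omega, (hp.mono (by omega)).smul this⟩

/-- Translation leaves the steps of a code unchanged, so the cores at one stage are translates of
each other. -/
lemma core_smul {n : ℕ} {f g : G} (hf : f ∈ S.F n) (hgf : g * f ∈ S.F n) :
    T.core n (g * f) = g • T.core n f := by
  ext x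
  rw [mem_smul_set_iff_inv_smul_mem, mem_core_iff hf, mem_core_iff hgf]
  constructor
  · rintro ⟨p, hp, h⟩
    exact ⟨_, hp.smul (by rwa [h, inv_mul_cancel_left]), by rw [h, inv_mul_cancel_left]⟩
  · rintro ⟨p, hp, rfl⟩
    have := hp.smul hgf
    rw [smul_inv_smul] at this
    exact ⟨_, this, rfl⟩

variable (T) in
include T in
theorem absorbing : S.Absorbing := by
  intro g n _
  obtain ⟨N, hN⟩ := eventually_atTop.1 (T.eventually_mul_mem g)
  have hsub : ∀ k, S.prodSet n k ⊆ (S.F (n + k) : Set G) := by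
    intro k
    induction k with
    | zero => exact Subset.rfl
    | succ k ih =>
      rintro _ ⟨a, ha, c, hc, rfl⟩
      exact S.mul_mem (n + k) a (ih ha) c hc
  refine ⟨N + 1, N.succ_pos, ?_⟩
  rintro _ ⟨_, ⟨a, ha, c, hc, rfl⟩, rfl⟩
  exact hN (n + N) (by omega) a (hsub N ha) c hc

lemma measurableSet_core (hns : QuasiInvariant G η) (n : ℕ) (f : G) :
    MeasurableSet (T.core n f) := by
  have := hns.measurableConstSMul
  refine ((T.measurableSet_A n).const_smul f).inter (MeasurableSet.iInter fun k =>
    MeasurableSet.iInter fun _ => Finset.measurableSet_biUnion _ fun h _ =>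
    Finset.measurableSet_biUnion _ fun c _ => (T.measurableSet_A (k + 1)).const_smul _)

lemma measurableSet_coded (hns : QuasiInvariant G η) : MeasurableSet T.coded :=
  MeasurableSet.iUnion fun n => Finset.measurableSet_biUnion _ fun f _ => measurableSet_core hns n f

/-- The level `f A_n` is a union of levels `h A_k`. Since `h` scales `η` on `A_k` by a constant,
each of them loses the same proportion as `A_k`. -/
lemma measure_level_diff_le (hns : QuasiInvariant G η) {n k : ℕ} (hnk : n ≤ k) {f : G}
    (hf : f ∈ S.F n) :
    η (f • T.A n \ ⋃ h ∈ S.F k, ⋃ c ∈ S.C (k + 1), (h * c) • T.A (k + 1)) ≤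
      2⁻¹ ^ k * η (f • T.A n) := by
  have := hns.measurableConstSMul
  obtain ⟨H, hH, e⟩ := T.refinement n k hnk f hf
  have hm : ∀ h : G, MeasurableSet (h • T.A k) := fun h => (T.measurableSet_A k).const_smul h
  set E := T.A k \ ⋃ c ∈ S.C (k + 1), c • T.A (k + 1) with hE
  have hEm : MeasurableSet E := (T.measurableSet_A k).diff
    (Finset.measurableSet_biUnion _ fun c _ => (T.measurableSet_A (k + 1)).const_smul c)
  have hsub : f • T.A n \ ⋃ h ∈ S.F k, ⋃ c ∈ S.C (k + 1), (h * c) • T.A (k + 1) ⊆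
      ⋃ h ∈ H, h • E := by
    rintro x ⟨hx, hx'⟩
    rw [e] at hx
    simp only [mem_iUnion, exists_prop, not_exists, not_and] at hx hx' ⊢
    obtain ⟨h, hh, y, hy, rfl⟩ := hx
    refine ⟨h, hh, smul_mem_smul_set ⟨hy, ?_⟩⟩
    simp only [mem_iUnion, exists_prop, not_exists, not_and]
    intro c hc hyc
    refine hx' h (hH hh) c hc ?_
    rw [mul_smul]
    exact smul_mem_smul_set hyc
  have hle : ∀ h ∈ H, η (h • E) ≤ 2⁻¹ ^ k * η (h • T.A k) := by
    intro h hh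
    obtain ⟨a, ha⟩ := T.scale k h (hH hh)
    rw [ha E sdiff_subset hEm, ha _ Subset.rfl (T.measurableSet_A k), mul_left_comm]
    gcongr
    exact T.loss k
  calc _ ≤ η (⋃ h ∈ H, h • E) := measure_mono hsub
    _ ≤ ∑ h ∈ H, η (h • E) := measure_biUnion_finset_le _ _
    _ ≤ ∑ h ∈ H, 2⁻¹ ^ k * η (h • T.A k) := Finset.sum_le_sum hle
    _ = 2⁻¹ ^ k * η (f • T.A n) := by
      rw [← Finset.mul_sum, e, measure_biUnion_finset]
      · intro h hh h' hh' hne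
        exact Set.disjoint_left.2 fun x hx hx' =>
          hne (T.eq_of_mem k h (hH hh) h' (hH hh') x hx hx')
      · exact fun h _ => hm h

/-- Borel-Cantelli: the losses within a fixed level are summable. -/
lemma measure_coded_compl [Countable G] (hns : QuasiInvariant G η) : η T.codedᶜ = 0 := by
  have h1 : ∀ n, ∀ f ∈ S.F n, ∀ᵐ x ∂η, x ∈ f • T.A n → ∀ᶠ k in atTop,
      x ∈ ⋃ h ∈ S.F k, ⋃ c ∈ S.C (k + 1), (h * c) • T.A (k + 1) := by
    intro n f hf
    let N : ℕ → Set Z := fun k =>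
      f • T.A n \ ⋃ h ∈ S.F (n + k), ⋃ c ∈ S.C (n + k + 1), (h * c) • T.A (n + k + 1)
    have hN : ∀ k, η (N k) ≤ 2⁻¹ ^ k * η (f • T.A n) := fun k => by
      refine (measure_level_diff_le hns (Nat.le_add_right n k) hf).trans ?_
      gcongr ?_ * _
      exact pow_le_pow_of_le_one zero_le (ENNReal.inv_le_one.2 one_le_two) (by omega)
    have hsum : ∑' k, η (N k) ≠ ∞ := by
      refine ne_top_of_le_ne_top ?_ (ENNReal.tsum_le_tsum hN)
      rw [ENNReal.tsum_mul_right]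
      refine ENNReal.mul_ne_top ?_ (T.level_lt_top n f hf).ne
      rw [ENNReal.tsum_geometric]
      simp
    filter_upwards [measure_eq_zero_iff_ae_notMem.1 (measure_limsup_atTop_eq_zero hsum)]
      with x hx hxf
    rw [mem_limsup_iff_frequently_mem, not_frequently] at hx
    obtain ⟨K, hK⟩ := eventually_atTop.1 hx
    filter_upwards [eventually_ge_atTop (n + K)] with k hk
    obtain ⟨j, rfl⟩ : ∃ j, k = n + j := ⟨k - n, by omega⟩
    by_contra h
    exact hK j (by omega) ⟨hxf, h⟩
  have h2 : ∀ᵐ x ∂η, ∀ n, ∀ f ∈ S.F n, x ∈ f • T.A n → ∀ᶠ k in atTop,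
      x ∈ ⋃ h ∈ S.F k, ⋃ c ∈ S.C (k + 1), (h * c) • T.A (k + 1) :=
    ae_all_iff.2 fun n => ae_all_iff.2 fun f => by
      by_cases hf : f ∈ S.F n
      · filter_upwards [h1 n f hf] with x hx _ using hx
      · exact .of_forall fun x h => absurd h hf
  refine mem_ae_iff.1 (show T.coded ∈ ae η from ?_)
  filter_upwards [h2, mem_ae_iff.2 T.measure_compl] with x hx hxΩ
  have hev := T.eventually_mem x hxΩ
  obtain ⟨n, f, hf, hxf⟩ := hev.exists
  obtain ⟨m, hm⟩ := eventually_atTop.1 (hx n f hf hxf)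
  obtain ⟨k, ⟨f', hf', hxk⟩, hk⟩ := (hev.and (eventually_ge_atTop m)).exists
  exact mem_iUnion.2 ⟨k, mem_biUnion hf' ⟨hxk, mem_iInter₂.2 fun j hj => hm j (hk.trans hj)⟩⟩

/-! ### The map into the `(C,F)`-space -/

variable (T) in
/-- The map that sends a coded point to the point of the `(C,F)`-space with the same code. -/
def code (x : Z) : S.Space :=
  open Classical in
  if h : ∃ n p, T.Codes n p x then S.point h.choose h.choose_spec.choose_spec.valid.toLevel
  else (cylinder_nonempty (S.one_mem_F 0)).choose

lemma Codes.germ_code {n : ℕ} {p : ℕ → G} {x : Z} (hp : T.Codes n p x) :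
    S.germ (T.code x) = (p : Germ atTop G) := by
  have hex : ∃ n p, T.Codes n p x := ⟨n, p, hp⟩
  have h := hex.choose_spec.choose_spec
  rw [code, dif_pos hex, h.valid.germ_point_toLevel, Germ.coe_eq]
  filter_upwards [eventually_ge_atTop n, eventually_ge_atTop hex.choose] with k h1 h2
  exact h.eq hp h2 h1

lemma code_mem_cylinder_iff {n : ℕ} {f : G} (hf : f ∈ S.F n) {x : Z} (hx : x ∈ T.coded) :
    T.code x ∈ S.cylinder n f ↔ x ∈ T.core n f := by
  obtain ⟨m, p, hp⟩ := mem_coded_iff.1 hx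
  rw [mem_core_iff hf, mem_cylinder_iff]
  constructor
  · rintro ⟨q, hq, rfl, h⟩
    refine ⟨q, Codes.of_eventually hq ?_, rfl⟩
    rw [hp.germ_code, Germ.coe_eq] at h
    filter_upwards [h, eventually_ge_atTop m] with k hk hmk
    rw [← hk]
    exact hp.mem k hmk
  · rintro ⟨q, hq, rfl⟩
    exact ⟨q, hq.valid, rfl, hq.germ_code⟩

lemma injOn_code : InjOn T.code T.coded := by
  intro x hx y hy h
  obtain ⟨n, p, hp⟩ := mem_coded_iff.1 hx
  obtain ⟨m, q, hq⟩ := mem_coded_iff.1 hy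
  by_contra hne
  have hg := hp.germ_code
  rw [h, hq.germ_code, Germ.coe_eq] at hg
  obtain ⟨k, ⟨h1, h2⟩, h3, h4⟩ := ((hg.and (T.eventually_separate x hp.mem_Ω y hq.mem_Ω hne)).and
    ((eventually_ge_atTop n).and (eventually_ge_atTop m))).exists
  exact h2 _ (hp.valid.mem_of_le h3) (hp.mem k h3) (h1 ▸ hq.mem k h4)

lemma code_smul [MulAction G S.Space] (hG : S.IsCFAction) {x : Z} (hx : x ∈ T.coded) (g : G) :
    T.code (g • x) = g • T.code x := by
  obtain ⟨n, p, hp⟩ := mem_coded_iff.1 hx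
  obtain ⟨m, -, hm⟩ := hp.exists_smul g
  apply germ_injective
  rw [hG.germ_smul T.absorbing, hp.germ_code, hm.germ_code]
  rfl

variable [TopologicalSpace G] [DiscreteTopology G] [Countable G] (hns : QuasiInvariant G η)
include hns

lemma measurable_code : Measurable T.code := by
  classical
  have hgen := measurableSpace_eq_generateFrom (P := fun n f => f ∈ S.F n) eventually_mem_cylinder
  suffices h : @Measurable _ _ _ (MeasurableSpace.generateFrom
      {U : Set S.Space | ∃ n f, f ∈ S.F n ∧ U = S.cylinder n f}) T.code from
    fun U hU => h (hgen.le U hU)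
  refine measurable_generateFrom ?_
  rintro _ ⟨n, f, hf, rfl⟩
  have : T.code ⁻¹' S.cylinder n f = T.core n f ∪ (T.codedᶜ ∩
      {_x | (cylinder_nonempty (S.one_mem_F 0)).choose ∈ S.cylinder n f}) := by
    ext x
    by_cases hx : x ∈ T.coded
    · simp [hx, code_mem_cylinder_iff hf hx]
    · have h1 : x ∉ T.core n f := fun h => hx (core_subset_coded hf h)
      have h2 : T.code x = (cylinder_nonempty (S.one_mem_F 0)).choose :=
        dif_neg fun h => hx (mem_coded_iff.2 h)
      simp [hx, h1, h2]
  rw [this]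
  exact (measurableSet_core hns n f).union ((measurableSet_coded hns).compl.inter (.const _))

lemma map_code_cylinder {n : ℕ} {f : G} (hf : f ∈ S.F n) :
    η.map T.code (S.cylinder n f) = η (T.core n f) := by
  rw [Measure.map_apply (measurable_code hns) (measurableSet_cylinder n f),
    ← measure_inter_conull (measure_coded_compl (T := T) hns)]
  congr 1
  ext x
  refine ⟨fun h => (code_mem_cylinder_iff hf h.2).1 h.1, fun h => ?_⟩
  exact ⟨(code_mem_cylinder_iff hf (core_subset_coded hf h)).2 h, core_subset_coded hf h⟩

lemma map_code_subsingleton [NullSingletonClass η] {s : Set S.Space} (hs : s.Subsingleton) :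
    η.map T.code s = 0 := by
  rw [Measure.map_apply (measurable_code hns) hs.measurableSet,
    ← measure_inter_conull (measure_coded_compl (T := T) hns)]
  refine Set.Subsingleton.measure_zero ?_ η
  rintro x ⟨hx, hx'⟩ y ⟨hy, hy'⟩
  exact injOn_code hx' hy' (hs hx hy)

omit [TopologicalSpace G] [DiscreteTopology G] in
lemma coded_not_countable [NullSingletonClass η] : ¬ T.coded.Countable := by
  intro h
  have h0 : η univ = 0 := by
    rw [← union_compl_self T.coded]
    exact measure_union_null (h.measure_zero η) (measure_coded_compl hns)
  exact (T.pos 0).ne' (measure_mono_null (subset_univ _) h0)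

omit [TopologicalSpace G] [DiscreteTopology G] [Countable G] hns in
lemma core_lt_top {n : ℕ} {f : G} (hf : f ∈ S.F n) : η (T.core n f) < ∞ :=
  (measure_mono core_subset_level).trans_lt (T.level_lt_top n f hf)

omit [TopologicalSpace G] [DiscreteTopology G] [Countable G] hns in
lemma core_subset {n k : ℕ} (hnk : n ≤ k) {p : ℕ → G} (hp : S.Valid n p) :
    T.core k (p k) ⊆ T.core n (p n) := by
  have hk := hp.mem_of_le hnk
  intro x hx
  have hc := core_subset_coded hk hx
  rw [← code_mem_cylinder_iff hk hc] at hx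
  rw [← code_mem_cylinder_iff hp.mem hc]
  exact hp.cylinder_subset hnk hx

-- If one core at stage `n` were null, then by translation and nesting so would be all cores at
-- stages `k ≥ n`. These cover the conull set of coded points.
omit [TopologicalSpace G] [DiscreteTopology G] in
lemma core_pos {n : ℕ} {f : G} (hf : f ∈ S.F n) : 0 < η (T.core n f) := by
  have h1 : ∀ k, ∀ f ∈ S.F k, η (T.core k 1) = 0 → η (T.core k f) = 0 := by
    intro k f hf h
    have := core_smul (T := T) (g := f) (S.one_mem_F k) (by simpa using hf)
    rw [mul_one] at this
    rw [this]
    exact hns.measure_smul_eq_zero h f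
  rw [pos_iff_ne_zero]
  intro h
  have hn : η (T.core n 1) = 0 := by
    have := core_smul (T := T) (g := f⁻¹) hf (by simpa using S.one_mem_F n)
    rw [inv_mul_cancel] at this
    rw [this]
    exact hns.measure_smul_eq_zero h _
  have hk : ∀ k, n ≤ k → ∀ f ∈ S.F k, η (T.core k f) = 0 := fun k hk f hf =>
    h1 k f hf (measure_mono_null (core_subset hk (valid_const (S.one_mem_F n))) hn)
  have hcov : T.coded ⊆ ⋃ k ≥ n, ⋃ f ∈ S.F k, T.core k f := by
    intro x hx
    obtain ⟨m, p, hp⟩ := mem_coded_iff.1 hx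
    have hp' := hp.mono (le_max_right n m)
    exact mem_iUnion₂.2 ⟨max n m, le_max_left _ _, mem_biUnion hp'.valid.mem
      ((mem_core_iff hp'.valid.mem).2 ⟨p, hp', rfl⟩)⟩
  have h0 : η T.coded = 0 := measure_mono_null hcov (measure_iUnion_null fun k =>
    measure_iUnion_null fun hk' => (measure_biUnion_null_iff (Finset.countable_toSet _)).2
      fun f hf => hk k hk' f hf)
  have huniv : η univ = 0 := by
    rw [← union_compl_self T.coded]
    exact measure_union_null h0 (measure_coded_compl hns)
  exact (T.pos 0).ne' (measure_mono_null (subset_univ _) huniv)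

/-! ### The weights -/

variable (T) in
/-- The measure of the part of the level `f A_n` that corresponds to the cylinder `[f]_n`. -/
def weight (n : ℕ) (f : G) : ℝ≥0 := (η (T.core n f)).toNNReal

omit [TopologicalSpace G] [DiscreteTopology G] [Countable G] hns in
lemma coe_weight {n : ℕ} {f : G} (hf : f ∈ S.F n) : (T.weight n f : ℝ≥0∞) = η (T.core n f) :=
  ENNReal.coe_toNNReal (core_lt_top hf).ne

omit [TopologicalSpace G] [DiscreteTopology G] in
lemma weight_pos {n : ℕ} {f : G} (hf : f ∈ S.F n) : 0 < T.weight n f :=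
  ENNReal.toNNReal_pos (core_pos hns hf).ne' (core_lt_top hf).ne

-- Both `core (n + 1) c` and `core n 1` lie in `A_n`, so translation by `f` scales their measures by
-- the same constant.
omit [TopologicalSpace G] [DiscreteTopology G] in
lemma weight_mul {n : ℕ} {f c : G} (hf : f ∈ S.F n) (hc : c ∈ S.C (n + 1)) :
    T.weight (n + 1) (f * c) = T.weight n f * (T.weight (n + 1) c / T.weight n 1) := by
  have h1 := S.one_mem_F n
  have hcF : c ∈ S.F (n + 1) := by simpa using S.mul_mem n 1 h1 c hc
  have hfc := S.mul_mem n f hf c hc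
  obtain ⟨a, ha⟩ := T.scale n f hf
  have hsub1 : T.core n 1 ⊆ T.A n := core_subset_level.trans (by rw [one_smul])
  have hsubc : T.core (n + 1) c ⊆ T.A n :=
    core_subset_level.trans (T.subset n c hc)
  have e1 : T.weight (n + 1) (f * c) = a * T.weight (n + 1) c := by
    rw [← ENNReal.coe_inj, ENNReal.coe_mul, coe_weight hfc, coe_weight hcF, core_smul hcF hfc,
      ha _ hsubc (measurableSet_core hns _ _)]
  have e2 : T.weight n f = a * T.weight n 1 := by
    have := core_smul (T := T) (g := f) h1 (by simpa using hf)
    rw [mul_one] at this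
    rw [← ENNReal.coe_inj, ENNReal.coe_mul, coe_weight hf, coe_weight h1, this,
      ha _ hsub1 (measurableSet_core hns _ _)]
  rw [e1, e2, mul_assoc, mul_div_cancel₀ _ (weight_pos hns h1).ne']

lemma sum_weight (n : ℕ) : ∑ c ∈ S.C (n + 1), T.weight (n + 1) c = T.weight n 1 := by
  have h1 := S.one_mem_F n
  have hC : ∀ c ∈ S.C (n + 1), c ∈ S.F (n + 1) := fun c hc => by
    simpa using S.mul_mem n 1 h1 c hc
  rw [← ENNReal.coe_inj, coe_weight h1, ENNReal.ofNNReal_finsetSum, ← map_code_cylinder hns h1,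
    measure_cylinder_eq_sum _ h1]
  refine Finset.sum_congr rfl fun c hc => ?_
  rw [coe_weight (hC c hc), one_mul, map_code_cylinder hns (hC c hc)]

/-- The nested cylinders shrink to at most one point, and the image measure has no atoms because
coding is injective on a conull set. -/
lemma tendsto_weight [NullSingletonClass η] {p : ℕ → G} (hp : S.Valid 0 p) :
    Tendsto (fun n => T.weight n (p n)) atTop (𝓝 0) := by
  have hF : ∀ n, p n ∈ S.F n := fun n => hp.mem_of_le (Nat.zero_le n)
  have h := tendsto_measure_iInter_atTop (μ := η.map T.code) (s := fun n => S.cylinder n (p n))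
    (fun n => (measurableSet_cylinder n _).nullMeasurableSet)
    (fun n m hnm => (hp.mono (Nat.zero_le n)).cylinder_subset hnm)
    ⟨0, by rw [map_code_cylinder hns (hF 0)]; exact (core_lt_top (hF 0)).ne⟩
  have hs : (⋂ n, S.cylinder n (p n)).Subsingleton := by
    have := iInter_cylinder_subsingleton (S := S) (n := 0) p
    simpa using this
  rw [map_code_subsingleton hns hs] at h
  rw [← ENNReal.tendsto_coe]
  refine h.congr fun n => ?_
  rw [Function.comp_apply, map_code_cylinder hns (hF n), coe_weight (hF n)]

/-- Choosing a maximizing `c` at every stage defines one point, and the product of maxima telescopes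
to the normalized masses of its cylinders. -/
lemma tendsto_prod_sup_weight [NullSingletonClass η] : Tendsto (fun N : ℕ => ∏ n ∈ Finset.Icc 1 N,
    (S.C n).sup fun c => T.weight n c / T.weight (n - 1) 1) atTop (𝓝 0) := by
  have hex : ∀ n, ∃ c ∈ S.C (n + 1), ((S.C (n + 1)).sup fun c => T.weight (n + 1) c /
      T.weight n 1) = T.weight (n + 1) c / T.weight n 1 := fun n =>
    Finset.exists_mem_eq_sup _ ⟨1, S.one_mem_C (n + 1) (by omega)⟩ _
  choose c hc hsup using hex
  let p : ℕ → G := fun n => Nat.rec 1 (fun n a => a * c n) n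
  have hp : S.Valid 0 p := ⟨S.one_mem_F 0, fun k _ => by
    change (p k)⁻¹ * (p k * c k) ∈ _
    rw [inv_mul_cancel_left]
    exact hc k⟩
  have hprod : ∀ N : ℕ, ∏ n ∈ Finset.Icc 1 N, ((S.C n).sup fun c => T.weight n c /
      T.weight (n - 1) 1) = T.weight N (p N) / T.weight 0 1 := by
    intro N
    induction N with
    | zero => exact (div_self (weight_pos (T := T) hns (S.one_mem_F 0)).ne').symm
    | succ N ih =>
      rw [Finset.prod_Icc_succ_top (by omega), ih, Nat.add_sub_cancel, hsup N,
        show p (N + 1) = p N * c N from rfl, weight_mul hns (hp.mem_of_le (Nat.zero_le N)) (hc N),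
        div_mul_eq_mul_div]
  simp only [hprod]
  simpa using (tendsto_weight (T := T) hns hp).div_const (T.weight 0 1)

variable (T) in
/-- The weights of the `(C,F)`-measure that is isomorphic to the given one. -/
def cfWeights [NullSingletonClass η] : CFWeights S where
  κ n c := T.weight n c / T.weight (n - 1) 1
  ν := T.weight
  κ_pos n hn c hc := by
    obtain ⟨n, rfl⟩ : ∃ k, n = k + 1 := ⟨n - 1, by omega⟩
    refine div_pos (weight_pos hns ?_) (weight_pos hns (S.one_mem_F _))
    simpa using S.mul_mem n 1 (S.one_mem_F n) c hc
  κ_sum n hn := by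
    obtain ⟨n, rfl⟩ : ∃ k, n = k + 1 := ⟨n - 1, by omega⟩
    rw [← Finset.sum_div, sum_weight hns]
    exact div_self (weight_pos hns (S.one_mem_F n)).ne'
  ν_pos n f hf := weight_pos hns hf
  prod_max := tendsto_prod_sup_weight hns
  ν_mul n f hf c hc := weight_mul hns hf hc

lemma isCFMeasure_map_code [NullSingletonClass η] :
    (T.cfWeights hns).IsCFMeasure (η.map T.code) := fun n f hf => by
  rw [map_code_cylinder hns hf]
  exact (coe_weight hf).symm

end CFTowers

end RankOne

end

/-! ### The isomorphic `(C,F)`-model. -/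

theorem theorem1p19 {G : Type*} [Group G] [Countable G] [Infinite G]
    [TopologicalSpace G] [DiscreteTopology G]
    {Z : Type*} [MeasurableSpace Z] [StandardBorelSpace Z] [MulAction G Z]
    (η : Measure Z) [SigmaFinite η] [NullSingletonClass η]
    (hns : RankOne.QuasiInvariant G η) (hfree : RankOne.FreeAE G η)
    (Q : ℕ → Finset G) (hQ : RankOne.IsRankOneAlong η Q) :
    ∃ (S : RankOne.CFShape G) (w : RankOne.CFWeights S) (_ : MulAction G S.Space)
      (μ' : Measure S.Space),
      -- the model is the `(C,F)`-action of a parameter sequence with the absorbing property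
      S.Absorbing ∧ S.IsCFAction ∧ w.IsCFMeasure μ' ∧
      -- its space is a locally compact Cantor space, and the action is continuous, minimal, free
      -- and Radon uniquely ergodic
      RankOne.IsLocallyCompactCantor S.Space ∧ ContinuousConstSMul G S.Space ∧
      MulAction.IsMinimal G S.Space ∧ (∀ g : G, g ≠ 1 → ∀ x : S.Space, g • x ≠ x) ∧
      RankOne.IsRadonUniquelyErgodic G S.Space ∧
      (∃! ξ : Measure S.Space, ξ.Regular ∧ SMulInvariantMeasure G S.Space ξ ∧
        ξ (Set.range (S.point 0)) = 1) ∧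
      -- its measure is Radon and quasi-invariant, its derivatives are continuous, and the action is
      -- Radon uniquely ergodic for the Radon-Nikodym cocycle
      μ'.Regular ∧ RankOne.QuasiInvariant G μ' ∧
      (∃ ρ : G → S.Space → ℝ≥0, RankOne.IsCocycle ρ ∧ (∀ g, Continuous (ρ g)) ∧
        RankOne.HasRNCocycle μ' ρ ∧ RankOne.IsRadonCocycleUniquelyErgodic ρ) ∧
      -- it is isomorphic to the given action
      (∃ φ : Z ≃ᵐ S.Space, MeasurePreserving φ η μ' ∧
        ∀ g : G, ∀ᵐ z ∂η, φ (g • z) = g • φ z) ∧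
      -- its shapes are translates of shapes from a subsequence of the given sequence
      (∃ (z : ℕ → G) (l : ℕ → ℕ), (∀ n, z n ∈ Q n) ∧ StrictMono l ∧
        ∀ n, 1 ≤ n → (S.F n : Set G) = (fun q => q * (z (l n))⁻¹) '' (Q (l n) : Set G)) := by
  obtain ⟨E⟩ := hQ.nonempty_exactTowers hns hfree
  obtain ⟨S, T, z, l, hz, hl, hF⟩ := E.exists_CFTowers hns
  have hA : S.Absorbing := T.absorbing
  let := hA.mulAction
  have hG : S.IsCFAction := hA.isCFAction
  have hμ := RankOne.CFTowers.isCFMeasure_map_code (T := T) hns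
  have hρ := hμ.hasRNCocycle hA hG
  have hm := RankOne.CFTowers.measurable_code (T := T) hns
  have : StandardBorelSpace S.Space := RankOne.standardBorelSpace_of_locallyCompact
  have hcoded := RankOne.CFTowers.measure_coded_compl (T := T) hns
  obtain ⟨φ, hφ⟩ := RankOne.exists_measurableEquiv_ae_eq η
    (RankOne.CFTowers.measurableSet_coded (T := T) hns)
    (RankOne.CFTowers.coded_not_countable hns) hcoded hm RankOne.CFTowers.injOn_code
  refine ⟨S, T.cfWeights hns, inferInstance, η.map T.code, hA, hG, hμ, S.isLocallyCompactCantor,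
    hG.continuousConstSMul hA, hG.isMinimal, fun g hg => hG.smul_ne hA hg,
    RankOne.CFShape.isRadonUniquelyErgodic hA hG, RankOne.CFShape.existsUnique_invariant hA hG,
    hμ.regular, hρ.1, ⟨_, (T.cfWeights hns).isCocycle_cocycle hA hG,
      (T.cfWeights hns).continuous_cocycle hA, hρ, hμ.isRadonCocycleUniquelyErgodic hA hG⟩,
    ⟨φ, ⟨φ.measurable, Measure.map_congr hφ⟩, fun g => ?_⟩, z, l, hz, hl, fun n _ => hF n⟩
  -- Quasi-invariance ensures that `φ` agrees with the coding map at `g x` as well as at `x`.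
  filter_upwards [hφ, (hns g).ae hφ, mem_ae_iff.2 hcoded] with x h1 h2 h3
  rw [h1, h2, RankOne.CFTowers.code_smul hG h3]
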